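/- Let $A$ be a unital $C^*$-algebra, let $J_1,J_2\subset A$ be closed two-sided $*$-ideals with $J_1+J_2=A$, put $J=J_1\cap J_2$, and let $B$ be a $C^*$-algebra. A unital Kasparov $(A,B)$-module is a triple $x=(H,\rho,F)$ consisting of a Hilbert $B$-module $H$, a unital $*$-homomorphism $\rho\colon A\to\mathbb B(H)$ into the adjointable operators, and $F\in\mathbb B(H)$ such that $[F,\rho(a)]\sim0$, $\rho(a)(F^2-1)\sim0$ and $\rho(a)(F-F^*)\sim0$ for all $a\in A$, where $C\sim D$ means that $C-D$ is a "compact" operator of Hilbert modules (a norm limit of linear combinations of operators $z\mapsto x\langle y,z\rangle$). For an ideal $I\subset A$ let $\rho[I]H$ be the sub-bimodule spanned by the vectors $\rho(a)\xi$, $a\in I$, $\xi\in H$. Two such triples $(H,\rho,F)$ and $(H',\rho',F')$ are said to agree on $I$ if there is a unitary isomorphism of $(A,B)$-bimodules $T\colon\rho[I]H\to\rho'[I]H'$ with $T\rho(c)F\rho(d)\sim\rho'(c)F'\rho'(d)T$ for all $c,d\in I$. Let $x=(H,\rho,F)$ and $\widetilde x=(\widetilde H,\widetilde\rho,\widetilde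 F)$ be unital Kasparov $(A,B)$-modules that agree on $J$ via $T$. Write $H_1=\rho[J_1]H$, $H_0=\rho[J]H$, $\widetilde H_2=\widetilde\rho[J_2]\widetilde H$, $\widetilde H_0=\widetilde\rho[J]\widetilde H$, and set $$H\diamond\widetilde H=(H_1\oplus\widetilde H_2)\big/\{(\xi_1,\xi_2)\colon \xi_1\in H_0,\ \xi_2\in\widetilde H_0,\ T\xi_1+\xi_2=0\},$$ with the action $(\rho\diamond\widetilde\rho)(a)[(\xi_1,\xi_2)]=[(\rho(a)\xi_1,\widetilde\rho(a)\xi_2)]$ of $A$ and the induced action of $B$. For $\xi=[(\xi_1,\xi_2)]$ write $\varphi\xi=\rho(\varphi)\xi_1+T^{*}\widetilde\rho(\varphi)\xi_2\in H_1$ if $\varphi\in J_1$, and $\varphi\xi=T\rho(\varphi)\xi_1+\widetilde\rho(\varphi)\xi_2\in\widetilde H_2$ if $\varphi\in J_2$. Given positive elements $\psi_1\in J_1$, $\psi_2\in J_2$ with $\psi_1^2+\psi_2^2=1$ and $[\psi_1,\psi_2]=0$, equip $H\diamond\widetilde H$ with $$\langle\xi,\eta\rangle=\langle\psi_1^2\xi,\psi_1^2\eta\rangle_H+\langle\psi_2^2\xi,\psi_2^2\eta\rangle_{\widetilde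 H}+2\langle\psi_1\psi_2\xi,\psi_1\psi_2\eta\rangle_H$$ (here $\psi_1\psi_2\in J$ is regarded as an element of $J_1$) and let $$(F\diamond\widetilde F)\xi=[(\rho(\psi_1)F(\psi_1\xi),\ \widetilde\rho(\psi_2)\widetilde F(\psi_2\xi))].$$ **Theorem 1.** For every such pair $(\psi_1,\psi_2)$, the triple $x\diamond\widetilde x=(H\diamond\widetilde H,\rho\diamond\widetilde\rho,F\diamond\widetilde F)$ is a unital Kasparov $(A,B)$-module. It agrees with $x$ on $J_1$ via the natural map $H_1\ni\xi_1\mapsto[(\xi_1,0)]$, which is a unitary isomorphism onto $(\rho\diamond\widetilde\rho)[J_1](H\diamond\widetilde H)$, and with $\widetilde x$ on $J_2$ via the natural map $\widetilde H_2\ni\xi_2\mapsto[(0,\xi_2)]$, which is a unitary isomorphism onto $(\rho\diamond\widetilde\rho)[J_2](H\diamond\widetilde H)$. Moreover, $x\diamond\widetilde x$ is independent of the choice of $(\psi_1,\psi_2)$ modulo "compact" perturbations: for any two choices, the inner products on $H\diamond\widetilde H$ coincide and the two operators $F\diamond\widetilde F$ differ by a "compact" operator. -/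

import Mathlib

open scoped InnerProductSpace

universe u v w w'

noncomputable section

/-! ### Hilbert `C⋆`-modules

`CStarModule B E` is Mathlib's notion of an inner product `B`-module, where the element `b` of `B`
acts as `b • ξ` with `⟪ξ, b • η⟫_B = b * ⟪ξ, η⟫_B`.  (A module with a right action `ξ · b` and
`⟪ξ, η · b⟫ = ⟪ξ, η⟫ b` is a `CStarModule Bᵐᵒᵖ E`; `Bᵐᵒᵖ` is again a `C⋆`-algebra, and everything
below is stated for an arbitrary `C⋆`-algebra `B`.)  A Hilbert `B`-module is a complete one. -/

namespace HilbertMod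

variable (B : Type*) [NonUnitalCStarAlgebra B] [PartialOrder B] [StarOrderedRing B]
variable {E E' : Type*}
  [NormedAddCommGroup E] [NormedSpace ℂ E] [SMul B E] [CStarModule B E]
  [NormedAddCommGroup E'] [NormedSpace ℂ E'] [SMul B E'] [CStarModule B E']

/-- The operator `z ↦ x⟨y, z⟩`. -/
def IsRankOne (R : E →ₗ[ℂ] E') : Prop := ∃ (x : E') (y : E), ∀ z, R z = ⟪y, z⟫_B • x

/-- "Compact" operators: the operator-norm limits of linear combinations of the operators
`z ↦ x⟨y, z⟩`. -/
def IsCompactOp (S : E →ₗ[ℂ] E') : Prop :=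
  ∀ ε : ℝ, 0 < ε → ∃ R ∈ Submodule.span ℂ {R : E →ₗ[ℂ] E' | IsRankOne B R},
    ∀ z, ‖S z - R z‖ ≤ ε * ‖z‖

/-- `S'` is the adjoint of `S`. -/
def IsAdjointPair (S : E →ₗ[ℂ] E') (S' : E' →ₗ[ℂ] E) : Prop :=
  ∀ ξ η, ⟪S ξ, η⟫_B = ⟪ξ, S' η⟫_B

variable {B}

theorem ext_inner {ξ η : E} (h : ∀ z : E, ⟪z, ξ⟫_B = ⟪z, η⟫_B) : ξ = η := by
  have h1 : ⟪ξ - η, ξ - η⟫_B = 0 := by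
    rw [CStarModule.inner_sub_right, h, sub_self]
  exact sub_eq_zero.mp (CStarModule.inner_self.mp h1)

theorem op_smul_add (b : B) (ξ η : E) : b • (ξ + η) = b • ξ + b • η :=
  ext_inner (B := B) fun z => by simp [mul_add]

theorem op_smul_zero (b : B) : b • (0 : E) = 0 :=
  ext_inner (B := B) fun z => by simp

theorem op_smul_complex (b : B) (c : ℂ) (ξ : E) : b • (c • ξ) = c • (b • ξ) :=
  ext_inner (B := B) fun z => by simp [mul_smul_comm]

/-- The action of `b` as a complex linear map. -/
def opSMul (E : Type*) [NormedAddCommGroup E] [NormedSpace ℂ E] [SMul B E] [CStarModule B E]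
    (b : B) : E →ₗ[ℂ] E where
  toFun ξ := b • ξ
  map_add' := op_smul_add b
  map_smul' c ξ := op_smul_complex b c ξ

end HilbertMod

open HilbertMod

/-- The data `(H, ρ, F)`: an inner product `B`-module `H` with a commuting unital action `ρ` of the
algebra `A`, and an operator `F` on `H`. -/
structure KTriple (A : Type u) (B : Type v) [CStarAlgebra A]
    [NonUnitalCStarAlgebra B] [PartialOrder B] [StarOrderedRing B] where
  /-- the underlying space -/
  H : Type w
  [normedAddCommGroup : NormedAddCommGroup H]
  [normedSpace : NormedSpace ℂ H]
  [smulB : SMul B H]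
  [cstarModule : CStarModule B H]
  /-- the action of `A` -/
  ρ : A →ₐ[ℂ] (H →ₗ[ℂ] H)
  ρ_smul : ∀ (a : A) (b : B) (ξ : H), ρ a (b • ξ) = b • ρ a ξ
  /-- the operator -/
  F : H →ₗ[ℂ] H

attribute [instance] KTriple.normedAddCommGroup KTriple.normedSpace KTriple.smulB
  KTriple.cstarModule

namespace KTriple

variable {A : Type u} {B : Type v} [CStarAlgebra A]
  [NonUnitalCStarAlgebra B] [PartialOrder B] [StarOrderedRing B]

/-- `(H, ρ, F)` is a unital Kasparov `(A, B)`-module: `H` is a Hilbert `B`-module, `ρ` is a unital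
`*`-homomorphism into the adjointable operators, `F` is adjointable, and `[F, ρ(a)]`,
`ρ(a)(F² - 1)` and `ρ(a)(F - F*)` are "compact" for every `a`. -/
structure IsUnitalKasparov (x : KTriple A B) : Prop where
  complete : CompleteSpace x.H
  ρ_star : ∀ a : A, IsAdjointPair B (x.ρ a) (x.ρ (star a))
  commutator : ∀ a : A, IsCompactOp B (x.F ∘ₗ x.ρ a - x.ρ a ∘ₗ x.F)
  sq_sub_one : ∀ a : A, IsCompactOp B (x.ρ a ∘ₗ (x.F ∘ₗ x.F - LinearMap.id))
  adjoint : ∃ F' : x.H →ₗ[ℂ] x.H, IsAdjointPair B x.F F' ∧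
    ∀ a : A, IsCompactOp B (x.ρ a ∘ₗ (x.F - F'))

/-- The sub-bimodule `ρ[J]H`: the linear span of the vectors `ρ(a)ξ` with `a ∈ J`.  (For a
unital Kasparov module and a closed ideal `J` the set of these vectors is already a closed
subspace, by Cohen's factorization theorem.) -/
def sub (x : KTriple A B) (J : TwoSidedIdeal A) : Submodule ℂ x.H :=
  Submodule.span ℂ {ζ | ∃ a ∈ J, ∃ ξ : x.H, x.ρ a ξ = ζ}

variable (x : KTriple.{u, v, w} A B) {J J₁ J₂ : TwoSidedIdeal A}

theorem ρ_mul_apply (a c : A) (ξ : x.H) : x.ρ (a * c) ξ = x.ρ a (x.ρ c ξ) := by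
  simp

theorem ρ_mem_sub {c : A} (hc : c ∈ J) (ξ : x.H) : x.ρ c ξ ∈ x.sub J :=
  Submodule.subset_span ⟨c, hc, ξ, rfl⟩

theorem sub_mono (h : J₁ ≤ J₂) : x.sub J₁ ≤ x.sub J₂ :=
  Submodule.span_mono fun _ ⟨a, ha, ξ, e⟩ => ⟨a, h ha, ξ, e⟩

theorem map_mem_sub {f : x.H →ₗ[ℂ] x.H}
    (h : ∀ a ∈ J₁, ∀ ξ, f (x.ρ a ξ) ∈ x.sub J₂) {ξ : x.H} (hξ : ξ ∈ x.sub J₁) :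
    f ξ ∈ x.sub J₂ := by
  have : x.sub J₁ ≤ (x.sub J₂).comap f :=
    Submodule.span_le.mpr fun _ ⟨a, ha, ξ, e⟩ => e ▸ h a ha ξ
  exact this hξ

theorem act_mem_sub (a : A) {ξ : x.H} (hξ : ξ ∈ x.sub J) : x.ρ a ξ ∈ x.sub J :=
  x.map_mem_sub (fun c hc η => x.ρ_mul_apply a c η ▸ x.ρ_mem_sub (J.mul_mem_left a c hc) η) hξ

theorem smul_mem_sub (b : B) {ξ : x.H} (hξ : ξ ∈ x.sub J) : b • ξ ∈ x.sub J :=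
  x.map_mem_sub (f := opSMul x.H b)
    (fun c hc η => (show b • x.ρ c η ∈ _ from x.ρ_smul c b η ▸ x.ρ_mem_sub hc (b • η))) hξ

theorem act_left_mem_inf {a : A} (ha : a ∈ J₁) {ξ : x.H} (hξ : ξ ∈ x.sub J₂) :
    x.ρ a ξ ∈ x.sub (J₁ ⊓ J₂) :=
  x.map_mem_sub (fun c hc η => x.ρ_mul_apply a c η ▸
    x.ρ_mem_sub ((TwoSidedIdeal.mem_inf A).mpr ⟨J₁.mul_mem_right a c ha, J₂.mul_mem_left a c hc⟩) η) hξ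

theorem act_right_mem_inf {a : A} (ha : a ∈ J₂) {ξ : x.H} (hξ : ξ ∈ x.sub J₁) :
    x.ρ a ξ ∈ x.sub (J₁ ⊓ J₂) :=
  x.map_mem_sub (fun c hc η => x.ρ_mul_apply a c η ▸
    x.ρ_mem_sub ((TwoSidedIdeal.mem_inf A).mpr ⟨J₁.mul_mem_left a c hc, J₂.mul_mem_right a c ha⟩) η) hξ

instance (J : TwoSidedIdeal A) : SMul B (x.sub J) :=
  ⟨fun b ξ => ⟨b • (ξ : x.H), x.smul_mem_sub b ξ.2⟩⟩

/-- `ρ[J]H` with the inner product restricted from `H`. -/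
instance (J : TwoSidedIdeal A) : CStarModule B (x.sub J) where
  inner ξ η := ⟪(ξ : x.H), (η : x.H)⟫_B
  inner_add_right := CStarModule.inner_add_right (A := B) (E := x.H)
  inner_self_nonneg := CStarModule.inner_self_nonneg (A := B) (E := x.H)
  inner_self := (CStarModule.inner_self (A := B) (E := x.H)).trans Submodule.coe_eq_zero
  inner_op_smul_right := CStarModule.inner_op_smul_right (A := B) (E := x.H)
  inner_smul_right_complex := CStarModule.inner_smul_right_complex (A := B) (E := x.H)
  star_inner ξ η := CStarModule.star_inner (A := B) (E := x.H) ξ η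
  norm_eq_sqrt_norm_inner_self ξ :=
    CStarModule.norm_eq_sqrt_norm_inner_self (A := B) (E := x.H) ξ

/-- The action of `a ∈ A` on `ρ[J]H`. -/
def act (J : TwoSidedIdeal A) (a : A) : x.sub J →ₗ[ℂ] x.sub J :=
  (x.ρ a).restrict fun _ h => x.act_mem_sub a h

/-- The operator `ρ(c)`, `c ∈ J`, as an operator from `H` to `ρ[J]H`. -/
def actInto (J : TwoSidedIdeal A) (c : J) : x.H →ₗ[ℂ] x.sub J :=
  (x.ρ c).codRestrict _ fun ξ => x.ρ_mem_sub c.2 ξ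

/-- The operator `ρ(φ)`, `φ ∈ J₁`, from `ρ[J₂]H` to `ρ[J₁ ∩ J₂]H`. -/
def actInf₁ (J₁ J₂ : TwoSidedIdeal A) (φ : J₁) : x.sub J₂ →ₗ[ℂ] x.sub (J₁ ⊓ J₂) :=
  (x.ρ φ).restrict fun _ h => x.act_left_mem_inf φ.2 h

/-- The operator `ρ(φ)`, `φ ∈ J₂`, from `ρ[J₁]H` to `ρ[J₁ ∩ J₂]H`. -/
def actInf₂ (J₁ J₂ : TwoSidedIdeal A) (φ : J₂) : x.sub J₁ →ₗ[ℂ] x.sub (J₁ ⊓ J₂) :=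
  (x.ρ φ).restrict fun _ h => x.act_right_mem_inf φ.2 h

/-- The operator `ρ(c) F ρ(d)`, `c, d ∈ J`, on `ρ[J]H`. -/
def compress (J : TwoSidedIdeal A) (c d : J) : x.sub J →ₗ[ℂ] x.sub J :=
  x.actInto J c ∘ₗ x.F ∘ₗ x.ρ d ∘ₗ (x.sub J).subtype

end KTriple

section

variable {A : Type u} {B : Type v} [CStarAlgebra A]
  [NonUnitalCStarAlgebra B] [PartialOrder B] [StarOrderedRing B]

/-- `x = (H, ρ, F)` and `y = (H', ρ', F')` agree on `J`: a unitary isomorphism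
`T : ρ[J]H → ρ'[J]H'` of `(A, B)`-bimodules such that `T ρ(c) F ρ(d) - ρ'(c) F' ρ'(d) T` is
"compact" for all `c, d ∈ J`. -/
structure Agreement (J : TwoSidedIdeal A) (x : KTriple.{u, v, w} A B) (y : KTriple.{u, v, w'} A B) where
  T : x.sub J ≃ₗ[ℂ] y.sub J
  inner_map : ∀ ξ η, ⟪T ξ, T η⟫_B = ⟪ξ, η⟫_B
  map_act : ∀ (a : A) ξ, T (x.act J a ξ) = y.act J a (T ξ)
  map_smul : ∀ (b : B) ξ, T (b • ξ) = b • T ξ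
  compact : ∀ c d : J,
    IsCompactOp B (T.toLinearMap ∘ₗ x.compress J c d - y.compress J c d ∘ₗ T.toLinearMap)

/-- The operator `F` of `y` is a "compact" perturbation of the operator of `x`, where the two
`(A, B)`-bimodules with inner products are identified via `U`. -/
structure IsCompactPerturbation (x : KTriple.{u, v, w} A B) (y : KTriple.{u, v, w'} A B) (U : x.H ≃ₗ[ℂ] y.H) : Prop where
  inner_map : ∀ ξ η, ⟪U ξ, U η⟫_B = ⟪ξ, η⟫_B
  map_ρ : ∀ (a : A) ξ, U (x.ρ a ξ) = y.ρ a (U ξ)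
  map_smul : ∀ (b : B) ξ, U (b • ξ) = b • U ξ
  compact : IsCompactOp B (U.toLinearMap ∘ₗ x.F - y.F ∘ₗ U.toLinearMap)

/-- Positive elements `ψ₁ ∈ J₁` and `ψ₂ ∈ J₂` with `ψ₁² + ψ₂² = 1` and `[ψ₁, ψ₂] = 0`. -/
structure SquarePartition [PartialOrder A] [StarOrderedRing A] (J₁ J₂ : TwoSidedIdeal A) where
  ψ₁ : J₁
  ψ₂ : J₂
  nonneg₁ : 0 ≤ (ψ₁ : A)
  nonneg₂ : 0 ≤ (ψ₂ : A)
  sq_add_sq : (ψ₁ : A) ^ 2 + (ψ₂ : A) ^ 2 = 1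
  commute : (ψ₁ : A) * ψ₂ = ψ₂ * ψ₁

namespace SquarePartition

variable [PartialOrder A] [StarOrderedRing A] {J₁ J₂ : TwoSidedIdeal A}

/-- `ψ₁²` as an element of `J₁`. -/
def sq₁ (ψ : SquarePartition J₁ J₂) : J₁ :=
  ⟨(ψ.ψ₁ : A) ^ 2, pow_two (ψ.ψ₁ : A) ▸ J₁.mul_mem_left _ _ ψ.ψ₁.2⟩

/-- `ψ₂²` as an element of `J₂`. -/
def sq₂ (ψ : SquarePartition J₁ J₂) : J₂ :=
  ⟨(ψ.ψ₂ : A) ^ 2, pow_two (ψ.ψ₂ : A) ▸ J₂.mul_mem_left _ _ ψ.ψ₂.2⟩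

/-- `ψ₁ψ₂` as an element of `J₁`. -/
def cross (ψ : SquarePartition J₁ J₂) : J₁ :=
  ⟨(ψ.ψ₁ : A) * ψ.ψ₂, J₁.mul_mem_right _ _ ψ.ψ₁.2⟩

end SquarePartition

/-! ### Gluing -/

namespace Agreement

variable {J₁ J₂ : TwoSidedIdeal A} {x : KTriple.{u, v, w} A B} {y : KTriple.{u, v, w'} A B} (T : Agreement (J₁ ⊓ J₂) x y)

/-- The inclusion of `ρ[J₁ ∩ J₂]H` in `ρ[J₁]H`. -/
abbrev incl₁ (J₁ J₂ : TwoSidedIdeal A) (x : KTriple A B) :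
    x.sub (J₁ ⊓ J₂) →ₗ[ℂ] x.sub J₁ :=
  Submodule.inclusion (x.sub_mono inf_le_left)

/-- The inclusion of `ρ[J₁ ∩ J₂]H` in `ρ[J₂]H`. -/
abbrev incl₂ (J₁ J₂ : TwoSidedIdeal A) (x : KTriple A B) :
    x.sub (J₁ ⊓ J₂) →ₗ[ℂ] x.sub J₂ :=
  Submodule.inclusion (x.sub_mono inf_le_right)

/-- The subspace `{(ξ₁, ξ₂) | ξ₁ ∈ H₀, ξ₂ ∈ H'₀, Tξ₁ + ξ₂ = 0}` of `H₁ ⊕ H'₂`, i.e. the range of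
`H₀ ∋ ζ ↦ (ζ, -Tζ)`. -/
def relations : Submodule ℂ (x.sub J₁ × y.sub J₂) :=
  LinearMap.range ((incl₁ J₁ J₂ x).prod (-(incl₂ J₁ J₂ y ∘ₗ T.T.toLinearMap)))

/-- The space `(H₁ ⊕ H'₂) / {(ξ₁, ξ₂) | ξ₁ ∈ H₀, ξ₂ ∈ H'₀, Tξ₁ + ξ₂ = 0}`. -/
def GluedSpace : Type _ := (x.sub J₁ × y.sub J₂) ⧸ T.relations

instance : AddCommGroup T.GluedSpace :=
  inferInstanceAs (AddCommGroup ((x.sub J₁ × y.sub J₂) ⧸ T.relations))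

instance : Module ℂ T.GluedSpace :=
  inferInstanceAs (Module ℂ ((x.sub J₁ × y.sub J₂) ⧸ T.relations))

/-- The class `[(ξ₁, ξ₂)]`. -/
def cls : (x.sub J₁ × y.sub J₂) →ₗ[ℂ] T.GluedSpace := T.relations.mkQ

/-- The natural map `ξ₁ ↦ [(ξ₁, 0)]` of `H₁`. -/
def ι₁ : x.sub J₁ →ₗ[ℂ] T.GluedSpace := T.cls ∘ₗ LinearMap.inl ℂ _ _

/-- The natural map `ξ₂ ↦ [(0, ξ₂)]` of `H'₂`. -/
def ι₂ : y.sub J₂ →ₗ[ℂ] T.GluedSpace := T.cls ∘ₗ LinearMap.inr ℂ _ _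

theorem cls_surjective : Function.Surjective T.cls := T.relations.mkQ_surjective

theorem cls_eq (ξ : x.sub J₁) (η : y.sub J₂) : T.cls (ξ, η) = T.ι₁ ξ + T.ι₂ η := by
  simp only [ι₁, ι₂, LinearMap.comp_apply, ← map_add]
  simp

theorem ι_eq (ζ : x.sub (J₁ ⊓ J₂)) : T.ι₁ (incl₁ J₁ J₂ x ζ) = T.ι₂ (incl₂ J₁ J₂ y (T.T ζ)) := by
  rw [← sub_eq_zero, sub_eq_add_neg, ← map_neg, ← cls_eq]
  exact (Submodule.Quotient.mk_eq_zero _).mpr ⟨ζ, rfl⟩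

/-- A pair of linear maps on `H₁` and `H'₂` compatible with the identification `T` descends. -/
def desc {V : Type*} [AddCommGroup V] [Module ℂ V]
    (f : x.sub J₁ →ₗ[ℂ] V) (g : y.sub J₂ →ₗ[ℂ] V)
    (h : ∀ ζ, f (incl₁ J₁ J₂ x ζ) = g (incl₂ J₁ J₂ y (T.T ζ))) : T.GluedSpace →ₗ[ℂ] V :=
  T.relations.liftQ (f.coprod g) <| by
    rintro _ ⟨ζ, rfl⟩
    simp [h]

theorem desc_cls {V : Type*} [AddCommGroup V] [Module ℂ V]
    (f : x.sub J₁ →ₗ[ℂ] V) (g : y.sub J₂ →ₗ[ℂ] V)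
    (h : ∀ ζ, f (incl₁ J₁ J₂ x ζ) = g (incl₂ J₁ J₂ y (T.T ζ))) (ξ : x.sub J₁) (η : y.sub J₂) :
    T.desc f g h (T.cls (ξ, η)) = f ξ + g η := rfl

/-- The action of `A` on the glued space, `a[(ξ₁, ξ₂)] = [(aξ₁, aξ₂)]`. -/
def gluedAct (a : A) : T.GluedSpace →ₗ[ℂ] T.GluedSpace :=
  T.desc (T.ι₁ ∘ₗ x.act J₁ a) (T.ι₂ ∘ₗ y.act J₂ a) fun ζ => by
    have h := T.ι_eq (x.act _ a ζ)
    rw [T.map_act] at h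
    exact h

theorem gluedAct_cls (a : A) (ξ : x.sub J₁) (η : y.sub J₂) :
    T.gluedAct a (T.cls (ξ, η)) = T.cls (x.act J₁ a ξ, y.act J₂ a η) := by
  exact (T.desc_cls (T.ι₁ ∘ₗ x.act J₁ a) (T.ι₂ ∘ₗ y.act J₂ a) _ ξ η).trans (T.cls_eq _ _).symm

/-- The unital homomorphism `A → End(H ⋄ H')`. -/
def gluedρ : A →ₐ[ℂ] (T.GluedSpace →ₗ[ℂ] T.GluedSpace) :=
  AlgHom.ofLinearMap
    { toFun := T.gluedAct
      map_add' := fun a c => by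
        refine LinearMap.ext fun z => ?_
        obtain ⟨⟨ξ, η⟩, rfl⟩ := T.cls_surjective z
        rw [LinearMap.add_apply, gluedAct_cls, gluedAct_cls, gluedAct_cls, ← map_add]
        congr 1
        ext <;> simp [KTriple.act]
      map_smul' := fun c a => by
        refine LinearMap.ext fun z => ?_
        obtain ⟨⟨ξ, η⟩, rfl⟩ := T.cls_surjective z
        rw [RingHom.id_apply, LinearMap.smul_apply, gluedAct_cls, gluedAct_cls, ← _root_.map_smul]
        congr 1
        ext <;> simp [KTriple.act] }
    (by
      refine LinearMap.ext fun z => ?_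
      obtain ⟨⟨ξ, η⟩, rfl⟩ := T.cls_surjective z
      change T.gluedAct 1 _ = _
      rw [gluedAct_cls, Module.End.one_apply]
      congr 1
      ext <;> simp [KTriple.act])
    (fun a c => by
      refine LinearMap.ext fun z => ?_
      obtain ⟨⟨ξ, η⟩, rfl⟩ := T.cls_surjective z
      change T.gluedAct (a * c) (T.cls (ξ, η)) = T.gluedAct a (T.gluedAct c (T.cls (ξ, η)))
      rw [gluedAct_cls, gluedAct_cls, gluedAct_cls]
      congr 1
      ext <;> simp [KTriple.act])

/-- The action of `B` on the glued space, `b • [(ξ₁, ξ₂)] = [(b • ξ₁, b • ξ₂)]`. -/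
instance : SMul B T.GluedSpace :=
  ⟨fun b => T.desc (T.ι₁ ∘ₗ opSMul (x.sub J₁) b) (T.ι₂ ∘ₗ opSMul (y.sub J₂) b) fun ζ => by
    have h := T.ι_eq (b • ζ)
    rw [T.map_smul] at h
    exact h⟩

theorem smul_cls (b : B) (ξ : x.sub J₁) (η : y.sub J₂) :
    b • T.cls (ξ, η) = T.cls (b • ξ, b • η) := by
  exact (T.desc_cls (T.ι₁ ∘ₗ opSMul (x.sub J₁) b) (T.ι₂ ∘ₗ opSMul (y.sub J₂) b) _ ξ η).trans
    (T.cls_eq _ _).symm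

/-- For `φ ∈ J₁`, the element `φξ = ρ(φ)ξ₁ + T*ρ'(φ)ξ₂` of `H₁`, where `ξ = [(ξ₁, ξ₂)]`. -/
def toLeft (φ : J₁) : T.GluedSpace →ₗ[ℂ] x.sub J₁ :=
  T.desc (x.act J₁ φ) (incl₁ J₁ J₂ x ∘ₗ T.T.symm.toLinearMap ∘ₗ y.actInf₁ J₁ J₂ φ) fun ζ => by
    have h : T.T.symm (y.act (J₁ ⊓ J₂) φ (T.T ζ)) = x.act (J₁ ⊓ J₂) φ ζ := by
      rw [← T.map_act, LinearEquiv.symm_apply_apply]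
    change incl₁ J₁ J₂ x (x.act (J₁ ⊓ J₂) φ ζ) =
      incl₁ J₁ J₂ x (T.T.symm (y.act (J₁ ⊓ J₂) φ (T.T ζ)))
    rw [h]

/-- For `φ ∈ J₂`, the element `φξ = Tρ(φ)ξ₁ + ρ'(φ)ξ₂` of `H'₂`, where `ξ = [(ξ₁, ξ₂)]`. -/
def toRight (φ : J₂) : T.GluedSpace →ₗ[ℂ] y.sub J₂ :=
  T.desc (incl₂ J₁ J₂ y ∘ₗ T.T.toLinearMap ∘ₗ x.actInf₂ J₁ J₂ φ) (y.act J₂ φ) fun ζ => by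
    change incl₂ J₁ J₂ y (T.T (x.act (J₁ ⊓ J₂) φ ζ)) =
      incl₂ J₁ J₂ y (y.act (J₁ ⊓ J₂) φ (T.T ζ))
    rw [T.map_act]

theorem toLeft_cls (φ : J₁) (ξ : x.sub J₁) (η : y.sub J₂) :
    T.toLeft φ (T.cls (ξ, η)) =
      x.act J₁ φ ξ + incl₁ J₁ J₂ x (T.T.symm (y.actInf₁ J₁ J₂ φ η)) := rfl

theorem toRight_cls (φ : J₂) (ξ : x.sub J₁) (η : y.sub J₂) :
    T.toRight φ (T.cls (ξ, η)) =
      incl₂ J₁ J₂ y (T.T (x.actInf₂ J₁ J₂ φ ξ)) + y.act J₂ φ η := rfl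

theorem toLeft_smul (φ : J₁) (b : B) (z : T.GluedSpace) :
    T.toLeft φ (b • z) = b • T.toLeft φ z := by
  obtain ⟨⟨ξ, η⟩, rfl⟩ := T.cls_surjective z
  have hs : ∀ ζ, T.T.symm (b • ζ) = b • T.T.symm ζ := fun ζ => by
    rw [LinearEquiv.symm_apply_eq, T.map_smul, LinearEquiv.apply_symm_apply]
  have h₁ : x.act J₁ φ (b • ξ) = b • x.act J₁ φ ξ := Subtype.ext (x.ρ_smul φ b ξ)
  have h₂ : y.actInf₁ J₁ J₂ φ (b • η) = b • y.actInf₁ J₁ J₂ φ η :=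
    Subtype.ext (y.ρ_smul φ b η)
  rw [smul_cls, toLeft_cls, toLeft_cls, op_smul_add, h₁, h₂, hs]
  rfl

theorem toRight_smul (φ : J₂) (b : B) (z : T.GluedSpace) :
    T.toRight φ (b • z) = b • T.toRight φ z := by
  obtain ⟨⟨ξ, η⟩, rfl⟩ := T.cls_surjective z
  have h₁ : y.act J₂ φ (b • η) = b • y.act J₂ φ η := Subtype.ext (y.ρ_smul φ b η)
  have h₂ : x.actInf₂ J₁ J₂ φ (b • ξ) = b • x.actInf₂ J₁ J₂ φ ξ :=
    Subtype.ext (x.ρ_smul φ b ξ)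
  rw [smul_cls, toRight_cls, toRight_cls, op_smul_add, h₁, h₂, T.map_smul]
  rfl

theorem ι₁_toLeft (φ : J₁) (z : T.GluedSpace) : T.ι₁ (T.toLeft φ z) = T.gluedAct φ z := by
  obtain ⟨⟨ξ, η⟩, rfl⟩ := T.cls_surjective z
  rw [gluedAct_cls, toLeft_cls, map_add, ι_eq, LinearEquiv.apply_symm_apply, cls_eq]
  rfl

theorem ι₂_toRight (φ : J₂) (z : T.GluedSpace) : T.ι₂ (T.toRight φ z) = T.gluedAct φ z := by
  obtain ⟨⟨ξ, η⟩, rfl⟩ := T.cls_surjective z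
  rw [gluedAct_cls, toRight_cls, map_add, ← ι_eq, cls_eq]
  rfl

variable [PartialOrder A] [StarOrderedRing A] (ψ : SquarePartition J₁ J₂)

/-- The inner product
`⟨ψ₁²ξ, ψ₁²η⟩ + ⟨ψ₂²ξ, ψ₂²η⟩ + 2⟨ψ₁ψ₂ξ, ψ₁ψ₂η⟩`. -/
def gluedInner (ξ η : T.GluedSpace) : B :=
  ⟪T.toLeft ψ.sq₁ ξ, T.toLeft ψ.sq₁ η⟫_B + ⟪T.toRight ψ.sq₂ ξ, T.toRight ψ.sq₂ η⟫_B +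
    2 • ⟪T.toLeft ψ.cross ξ, T.toLeft ψ.cross η⟫_B

theorem gluedInner_self_eq_zero {ξ : T.GluedSpace} : T.gluedInner ψ ξ ξ = 0 ↔ ξ = 0 := by
  constructor
  · intro h
    have p₁ : 0 ≤ ⟪T.toLeft ψ.sq₁ ξ, T.toLeft ψ.sq₁ ξ⟫_B := CStarModule.inner_self_nonneg
    have p₂ : 0 ≤ ⟪T.toRight ψ.sq₂ ξ, T.toRight ψ.sq₂ ξ⟫_B := CStarModule.inner_self_nonneg
    have p₃ : 0 ≤ 2 • ⟪T.toLeft ψ.cross ξ, T.toLeft ψ.cross ξ⟫_B :=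
      nsmul_nonneg CStarModule.inner_self_nonneg 2
    have h₁ := ((add_eq_zero_iff_of_nonneg (add_nonneg p₁ p₂) p₃).mp h).1
    obtain ⟨h₁, h₂⟩ := (add_eq_zero_iff_of_nonneg p₁ p₂).mp h₁
    have e₁ := T.ι₁_toLeft ψ.sq₁ ξ
    have e₂ := T.ι₂_toRight ψ.sq₂ ξ
    rw [CStarModule.inner_self.mp h₁, map_zero] at e₁
    rw [CStarModule.inner_self.mp h₂, map_zero] at e₂
    have e : T.gluedρ ((ψ.sq₁ : A) + ψ.sq₂) ξ = 0 := by
      rw [map_add, LinearMap.add_apply]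
      exact (congrArg₂ (· + ·) e₁ e₂).symm.trans (add_zero 0)
    have e₃ : (ψ.sq₁ : A) + ψ.sq₂ = 1 := ψ.sq_add_sq
    rwa [e₃, map_one] at e
  · rintro rfl
    simp [gluedInner]

/-- `H ⋄ H'` as an inner product `B`-module. -/
@[reducible]
def gluedCStarModule :
    @CStarModule B T.GluedSpace _ _ _ _ _ _ _ _
      (@CStarModule.norm B T.GluedSpace _ ⟨T.gluedInner ψ⟩) :=
  letI : Norm T.GluedSpace := @CStarModule.norm B T.GluedSpace _ ⟨T.gluedInner ψ⟩
  { inner := T.gluedInner ψ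
    inner_add_right := fun {ξ η ζ} => by
      simp only [gluedInner, map_add, CStarModule.inner_add_right, smul_add]
      abel
    inner_self_nonneg := fun {ξ} =>
      add_nonneg (add_nonneg CStarModule.inner_self_nonneg CStarModule.inner_self_nonneg)
        (nsmul_nonneg CStarModule.inner_self_nonneg 2)
    inner_self := T.gluedInner_self_eq_zero ψ
    inner_op_smul_right := fun {b ξ η} => by
      simp only [gluedInner, toLeft_smul, toRight_smul, CStarModule.inner_op_smul_right, mul_add,
        mul_smul_comm]
    inner_smul_right_complex := fun {c ξ η} => by
      simp only [gluedInner, LinearMap.map_smul, CStarModule.inner_smul_right_complex, smul_add,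
        smul_comm c]
    star_inner := fun ξ η => by
      simp only [gluedInner, star_add, star_nsmul, CStarModule.star_inner]
    norm_eq_sqrt_norm_inner_self := fun ξ => rfl }

/-- The operator `ψ₁Fψ₁ + ψ₂F'ψ₂` on the glued space. -/
def gluedF : T.GluedSpace →ₗ[ℂ] T.GluedSpace :=
  T.ι₁ ∘ₗ x.actInto J₁ ψ.ψ₁ ∘ₗ x.F ∘ₗ (x.sub J₁).subtype ∘ₗ T.toLeft ψ.ψ₁ +
    T.ι₂ ∘ₗ y.actInto J₂ ψ.ψ₂ ∘ₗ y.F ∘ₗ (y.sub J₂).subtype ∘ₗ T.toRight ψ.ψ₂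

/-- The glued triple `x ⋄ y = (H ⋄ H', ρ ⋄ ρ', ψ₁Fψ₁ + ψ₂F'ψ₂)`. -/
def glue : KTriple A B :=
  letI : Norm T.GluedSpace := @CStarModule.norm B T.GluedSpace _ ⟨T.gluedInner ψ⟩
  letI : CStarModule B T.GluedSpace := T.gluedCStarModule ψ
  letI : NormedAddCommGroup T.GluedSpace := CStarModule.normedAddCommGroup B
  letI : NormedSpace ℂ T.GluedSpace := NormedSpace.ofCore (CStarModule.normedSpaceCore B)
  { H := T.GluedSpace
    cstarModule := T.gluedCStarModule ψ
    ρ := T.gluedρ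
    ρ_smul := fun a b z => by
      obtain ⟨⟨ξ, η⟩, rfl⟩ := T.cls_surjective z
      change T.gluedAct a (b • T.cls (ξ, η)) = b • T.gluedAct a (T.cls (ξ, η))
      rw [smul_cls, gluedAct_cls, gluedAct_cls, smul_cls]
      congr 2
      · exact Subtype.ext (x.ρ_smul a b ξ)
      · exact Subtype.ext (y.ρ_smul a b η)
    F := T.gluedF ψ }

/-- The underlying linear space of the glued triple is the glued space. -/
def toGlue : T.GluedSpace ≃ₗ[ℂ] (T.glue ψ).H :=
  letI : Norm T.GluedSpace := @CStarModule.norm B T.GluedSpace _ ⟨T.gluedInner ψ⟩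
  letI : CStarModule B T.GluedSpace := T.gluedCStarModule ψ
  letI : NormedAddCommGroup T.GluedSpace := CStarModule.normedAddCommGroup B
  letI : NormedSpace ℂ T.GluedSpace := NormedSpace.ofCore (CStarModule.normedSpaceCore B)
  LinearEquiv.refl ℂ T.GluedSpace

end Agreement

end

end

-- Write $z = x\diamond\widetilde x$. The natural maps of $H_1$ and $\widetilde H_2$ into $z$ are
-- isometric bimodule maps $\iota_1,\iota_2$ (a `Chart` each), and $c\zeta$ lies in the range of
-- $\iota_i$ for $c\in J_i$. Each $c\in J_i$ thus gives a `push` $u\mapsto\iota_i(cu)$ from the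
-- original module to $z$ and a `pull` $\zeta\mapsto c\zeta$ back, and within one chart both
-- composites of a push with a pull are actions of products in the ideal. With $P_i,Q_i$ the push
-- and pull of $\psi_i$, the partition reads $P_1Q_1+P_2Q_2=1$, and the glued operator is
-- $P_1FQ_1+P_2\widetilde FQ_2$.
--
-- The analytic core is that the glued operator intertwines with $F$ along every push and every
-- pull, modulo "compacts" (`op_comp_push₁`, `pull_comp_op₁`). Composing a pull of one chart with a
-- push of the same chart gives some $\rho(a)$, which almost commutes with $F$; composing across
-- charts gives $u\mapsto T(cu)$ or $u\mapsto T^{*}(cu)$ with $c\in J_1\cap J_2$, which intertwines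
-- $F$ and $\widetilde F$ by the given agreement (`transfer_compactEq`). The commutator and square
-- conditions, independence of the partition and both new agreements then follow by inserting
-- $P_1Q_1+P_2Q_2=1$; the adjoint condition is checked termwise.
--
-- The inner product restricts to the given ones on the two charts because
-- $\psi_1^4+\psi_2^4+2\psi_1^2\psi_2^2=1$. The mixed product of $\iota_1\xi$ and $\iota_2\eta$ is a
-- pairing that sees only $\psi_1^2+\psi_2^2$ (`gluedInner_ι₁_ι₂`, `pairing_congr`), so it does not
-- depend on the partition and the action is a $*$-action.
--
-- The inclusion of $\rho[J]H$ in $H$ need not be adjointable. Elements of the ideals are therefore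
-- written as sums of products (`induction_on_mul`), and the spare factors supply adjointable maps
-- into and out of $\rho[J]H$.

universe w''

noncomputable section

open HilbertMod

set_option linter.unusedSectionVars false

/-! ### Factorization in closed $*$-ideals -/

namespace TwoSidedIdeal

variable {A : Type*} [CStarAlgebra A] {J : TwoSidedIdeal A}

theorem complex_smul_mem (c : ℂ) {a : A} (ha : a ∈ J) : c • a ∈ J := by
  rw [← one_mul a, ← smul_mul_assoc]
  exact J.mul_mem_left _ _ ha

/-- A closed `*`-ideal as a non-unital real `*`-subalgebra. -/
def toRealStarSubalgebra (J : TwoSidedIdeal A) (hstar : ∀ a ∈ J, star a ∈ J) :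
    NonUnitalStarSubalgebra ℝ A where
  carrier := J
  add_mem' := J.add_mem
  zero_mem' := J.zero_mem
  mul_mem' := fun _ hb => J.mul_mem_left _ _ hb
  smul_mem' := fun c a ha => by
    rw [← Complex.coe_smul]
    exact complex_smul_mem (c : ℂ) ha
  star_mem' := fun ha => hstar _ ha

theorem cfcₙ_mem_of_mem (hclosed : IsClosed (J : Set A)) (hstar : ∀ a ∈ J, star a ∈ J)
    (f : ℝ → ℝ) {a : A} (ha : a ∈ J) : cfcₙ f a ∈ J := by
  have : IsClosed ((J.toRealStarSubalgebra hstar : NonUnitalStarSubalgebra ℝ A) : Set A) := hclosed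
  exact NonUnitalStarSubalgebra.topologicalClosure_minimal (t := J.toRealStarSubalgebra hstar) _
    (by
      refine NonUnitalStarAlgebra.adjoin_le ?_
      rintro _ rfl
      exact ha) hclosed (cfcₙ_mem_elemental f a)

/-- A self-adjoint element of a closed `*`-ideal is a product of two elements of the ideal. -/
theorem exists_mul_eq_of_isSelfAdjoint (hclosed : IsClosed (J : Set A))
    (hstar : ∀ a ∈ J, star a ∈ J) {a : A} (ha : a ∈ J) (hsa : IsSelfAdjoint a) :
    ∃ b ∈ J, ∃ c ∈ J, b * c = a := by
  let g : ℝ → ℝ := fun t => √|t|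
  -- A signed square root: `f t * g t = t`, and both functions vanish at `0`, so the non-unital
  -- calculus keeps the factors in the ideal.
  let f : ℝ → ℝ := fun t => √(max t 0) - √(max (-t) 0)
  refine ⟨cfcₙ f a, cfcₙ_mem_of_mem hclosed hstar f ha, cfcₙ g a,
    cfcₙ_mem_of_mem hclosed hstar g ha, ?_⟩
  have hf : Continuous f := by fun_prop
  have hg : Continuous g := by fun_prop
  rw [← cfcₙ_mul f g a hf.continuousOn (by simp [f]) hg.continuousOn (by simp [g])]
  have h : (fun t => f t * g t) = id := by
    funext t
    rcases le_total 0 t with ht | ht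
    · simp [f, g, abs_of_nonneg ht, max_eq_left ht, max_eq_right (neg_nonpos.mpr ht),
        Real.mul_self_sqrt ht]
    · simp [f, g, abs_of_nonpos ht, max_eq_right ht, max_eq_left (neg_nonneg.mpr ht),
        Real.mul_self_sqrt (neg_nonneg.mpr ht)]
  rw [h]
  exact cfcₙ_id ℝ a

/-- A closed `*`-ideal is spanned by the products of its elements. -/
theorem induction_on_mul (hclosed : IsClosed (J : Set A)) (hstar : ∀ a ∈ J, star a ∈ J)
    {p : A → Prop} (hadd : ∀ a ∈ J, ∀ b ∈ J, p a → p b → p (a + b))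
    (hmul : ∀ a ∈ J, ∀ b ∈ J, p (a * b)) {a : A} (ha : a ∈ J) : p a := by
  -- The scalar is absorbed into the left factor, so `p` needs no homogeneity; real and imaginary
  -- parts then suffice.
  have hsa : ∀ b ∈ J, IsSelfAdjoint b → ∀ z : ℂ, p (z • b) := fun b hb hs z => by
    obtain ⟨c, hc, d, hd, rfl⟩ := exists_mul_eq_of_isSelfAdjoint hclosed hstar hb hs
    rw [← smul_mul_assoc]
    exact hmul _ (complex_smul_mem z hc) _ hd
  have hre : ((realPart a : selfAdjoint A) : A) ∈ J := by
    rw [realPart_apply_coe, ← Complex.coe_smul]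
    exact complex_smul_mem _ (J.add_mem ha (hstar a ha))
  have him : ((imaginaryPart a : selfAdjoint A) : A) ∈ J := by
    rw [imaginaryPart_apply_coe, ← Complex.coe_smul]
    exact complex_smul_mem _ (complex_smul_mem _ (J.sub_mem ha (hstar a ha)))
  have h := hadd _ (complex_smul_mem 1 hre) _ (complex_smul_mem Complex.I him)
    (hsa _ hre (realPart a).2 1) (hsa _ him (imaginaryPart a).2 Complex.I)
  rwa [one_smul, realPart_add_I_smul_imaginaryPart] at h

/-- Closed ideals that are stable under the involution. -/
structure IsClosedStar (J : TwoSidedIdeal A) : Prop where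
  isClosed : IsClosed (J : Set A)
  star_mem : ∀ a ∈ J, star a ∈ J

end TwoSidedIdeal

/-! ### Adjointable operators and calculus modulo "compacts" -/

namespace HilbertMod

variable {B : Type*} [NonUnitalCStarAlgebra B] [PartialOrder B] [StarOrderedRing B]
variable {E E' E'' : Type*}
  [NormedAddCommGroup E] [NormedSpace ℂ E] [SMul B E] [CStarModule B E]
  [NormedAddCommGroup E'] [NormedSpace ℂ E'] [SMul B E'] [CStarModule B E']
  [NormedAddCommGroup E''] [NormedSpace ℂ E''] [SMul B E''] [CStarModule B E'']

theorem ext_inner_left {ξ η : E} (h : ∀ z : E, ⟪ξ, z⟫_B = ⟪η, z⟫_B) : ξ = η :=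
  ext_inner (B := B) fun z => by
    rw [← CStarModule.star_inner ξ z, ← CStarModule.star_inner η z, h]

namespace IsAdjointPair

variable {S S₁ S₂ : E →ₗ[ℂ] E'} {S' S₁' S₂' : E' →ₗ[ℂ] E}

theorem symm (h : IsAdjointPair B S S') : IsAdjointPair B S' S := fun ξ η => by
  rw [← CStarModule.star_inner η (S' ξ), ← h η ξ, CStarModule.star_inner]

theorem comp {R : E' →ₗ[ℂ] E''} {R' : E'' →ₗ[ℂ] E'} (hR : IsAdjointPair B R R')
    (hS : IsAdjointPair B S S') : IsAdjointPair B (R ∘ₗ S) (S' ∘ₗ R') := fun ξ η => by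
  rw [LinearMap.comp_apply, hR, hS, LinearMap.comp_apply]

theorem add (h₁ : IsAdjointPair B S₁ S₁') (h₂ : IsAdjointPair B S₂ S₂') :
    IsAdjointPair B (S₁ + S₂) (S₁' + S₂') := fun ξ η => by
  rw [LinearMap.add_apply, LinearMap.add_apply, CStarModule.inner_add_left,
    CStarModule.inner_add_right, h₁, h₂]

theorem map_smul (h : IsAdjointPair B S S') (b : B) (ξ : E) : S (b • ξ) = b • S ξ :=
  ext_inner_left (B := B) fun z => by
    rw [h, CStarModule.inner_op_smul_left, CStarModule.inner_op_smul_left, h]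

/-- From $\|S'z\|^2=\|\langle SS'z,z\rangle\|$ and Cauchy–Schwarz. No completeness is involved, so
this applies to the submodules $\rho[J]H$ and to the glued module before it is known to be complete.
-/
theorem bound (h : IsAdjointPair B S S') {C : ℝ} (hC : 0 ≤ C) (hS : ∀ z, ‖S z‖ ≤ C * ‖z‖) (z : E') :
    ‖S' z‖ ≤ C * ‖z‖ := by
  have h₁ : ‖S' z‖ * ‖S' z‖ ≤ (C * ‖z‖) * ‖S' z‖ := by
    calc ‖S' z‖ * ‖S' z‖ = ‖⟪S' z, S' z⟫_B‖ := by
          rw [← pow_two, CStarModule.norm_sq_eq B]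
      _ = ‖⟪S (S' z), z⟫_B‖ := by rw [h]
      _ ≤ ‖S (S' z)‖ * ‖z‖ := CStarModule.norm_inner_le E'
      _ ≤ (C * ‖S' z‖) * ‖z‖ := by gcongr; exact hS _
      _ = _ := by ring
  rcases (norm_nonneg (S' z)).eq_or_lt with h₀ | h₀
  · rw [← h₀]; positivity
  · exact le_of_mul_le_mul_right h₁ h₀

end IsAdjointPair

variable (B) in
/-- Bounded `B`-linear operators. -/
structure IsBoundedModuleMap (S : E →ₗ[ℂ] E') : Prop where
  map_smul : ∀ (b : B) (ξ : E), S (b • ξ) = b • S ξ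
  bound : ∃ C : ℝ, 0 ≤ C ∧ ∀ z, ‖S z‖ ≤ C * ‖z‖

variable (B) in
/-- Bounded adjointable operators. -/
structure IsAdjointable (S : E →ₗ[ℂ] E') : Prop where
  adjoint : ∃ S', IsAdjointPair B S S'
  bound : ∃ C : ℝ, 0 ≤ C ∧ ∀ z, ‖S z‖ ≤ C * ‖z‖

theorem isBoundedModuleMap_of_inner_map {S : E →ₗ[ℂ] E'}
    (hS : ∀ ξ η, ⟪S ξ, S η⟫_B = ⟪ξ, η⟫_B) (hsmul : ∀ (b : B) ξ, S (b • ξ) = b • S ξ) :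
    IsBoundedModuleMap B S :=
  ⟨hsmul, 1, zero_le_one, fun z => by
    rw [one_mul, CStarModule.norm_eq_sqrt_norm_inner_self (A := B) (S z), hS,
      ← CStarModule.norm_eq_sqrt_norm_inner_self]⟩

namespace IsBoundedModuleMap

theorem comp {R : E' →ₗ[ℂ] E''} {S : E →ₗ[ℂ] E'} (hR : IsBoundedModuleMap B R)
    (hS : IsBoundedModuleMap B S) : IsBoundedModuleMap B (R ∘ₗ S) := by
  obtain ⟨C, hC, hR'⟩ := hR.bound
  obtain ⟨D, hD, hS'⟩ := hS.bound
  refine ⟨fun b ξ => by rw [LinearMap.comp_apply, hS.map_smul, hR.map_smul]; rfl,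
    C * D, by positivity, fun z => ?_⟩
  calc ‖R (S z)‖ ≤ C * ‖S z‖ := hR' _
    _ ≤ C * (D * ‖z‖) := by gcongr; exact hS' z
    _ = _ := by ring

end IsBoundedModuleMap

namespace IsAdjointable

theorem isBoundedModuleMap {S : E →ₗ[ℂ] E'} (hS : IsAdjointable B S) : IsBoundedModuleMap B S :=
  ⟨fun b ξ => hS.adjoint.elim fun _ h => h.map_smul b ξ, hS.bound⟩

theorem comp {R : E' →ₗ[ℂ] E''} {S : E →ₗ[ℂ] E'} (hR : IsAdjointable B R)
    (hS : IsAdjointable B S) : IsAdjointable B (R ∘ₗ S) := by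
  obtain ⟨R', hR'⟩ := hR.adjoint
  obtain ⟨S', hS'⟩ := hS.adjoint
  exact ⟨⟨_, hR'.comp hS'⟩, (hR.isBoundedModuleMap.comp hS.isBoundedModuleMap).bound⟩

end IsAdjointable

theorem IsAdjointPair.isAdjointable_right {S : E →ₗ[ℂ] E'} {S' : E' →ₗ[ℂ] E}
    (h : IsAdjointPair B S S') (hS : IsBoundedModuleMap B S) : IsAdjointable B S' := by
  obtain ⟨C, hC, hS⟩ := hS.bound
  exact ⟨⟨S, h.symm⟩, C, hC, h.bound hC hS⟩

/-- An operator with an adjoint between Hilbert modules is bounded. -/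
theorem IsAdjointPair.isAdjointable [CompleteSpace E] [CompleteSpace E'] {S : E →ₗ[ℂ] E'}
    {S' : E' →ₗ[ℂ] E} (h : IsAdjointPair B S S') : IsAdjointable B S := by
  have hc : Continuous S := by
    -- Closed graph theorem: the limit of $Su_n$ is identified by pairing it with each $z$ and
    -- moving $S$ to the other side.
    refine S.continuous_of_seq_closed_graph fun u ξ η hu hSu => ?_
    refine ext_inner_left (B := B) fun z => ?_
    have h₁ : Filter.Tendsto (fun n => ⟪S (u n), z⟫_B) Filter.atTop (nhds ⟪η, z⟫_B) :=
      ((CStarModule.continuous_inner (A := B)).tendsto (η, z)).comp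
        (hSu.prodMk_nhds tendsto_const_nhds)
    have h₂ : Filter.Tendsto (fun n => ⟪u n, S' z⟫_B) Filter.atTop (nhds ⟪ξ, S' z⟫_B) :=
      ((CStarModule.continuous_inner (A := B)).tendsto (ξ, S' z)).comp
        (hu.prodMk_nhds tendsto_const_nhds)
    rw [h]
    exact tendsto_nhds_unique h₁ (by simpa only [h _ z] using h₂)
  let S₀ : E →L[ℂ] E' := ⟨S, hc⟩
  exact ⟨⟨S', h⟩, ‖S₀‖, norm_nonneg _, S₀.le_opNorm⟩

namespace IsCompactOp

variable {S R : E →ₗ[ℂ] E'}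

theorem zero : IsCompactOp B (0 : E →ₗ[ℂ] E') := fun ε hε =>
  ⟨0, Submodule.zero_mem _, fun z => by simp; positivity⟩

theorem add (hS : IsCompactOp B S) (hR : IsCompactOp B R) : IsCompactOp B (S + R) := fun ε hε => by
  obtain ⟨S₁, hS₁, h₁⟩ := hS (ε / 2) (half_pos hε)
  obtain ⟨R₁, hR₁, h₂⟩ := hR (ε / 2) (half_pos hε)
  refine ⟨S₁ + R₁, Submodule.add_mem _ hS₁ hR₁, fun z => ?_⟩
  calc ‖(S + R) z - (S₁ + R₁) z‖ = ‖(S z - S₁ z) + (R z - R₁ z)‖ := by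
        congr 1; simp only [LinearMap.add_apply]; abel
    _ ≤ ε / 2 * ‖z‖ + ε / 2 * ‖z‖ := (norm_add_le _ _).trans (add_le_add (h₁ z) (h₂ z))
    _ = ε * ‖z‖ := by ring

theorem neg (hS : IsCompactOp B S) : IsCompactOp B (-S) := fun ε hε => by
  obtain ⟨S₁, hS₁, h₁⟩ := hS ε hε
  refine ⟨-S₁, Submodule.neg_mem _ hS₁, fun z => ?_⟩
  rw [LinearMap.neg_apply, LinearMap.neg_apply, neg_sub_neg, norm_sub_rev]
  exact h₁ z

/-- $L$ carries $x\langle y,\cdot\rangle$ to $(Lx)\langle y,\cdot\rangle$, so no adjoint of $L$ is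
needed on this side. This permits isometric inclusions as left factors. -/
theorem comp_left {L : E' →ₗ[ℂ] E''} (hL : IsBoundedModuleMap B L) (hS : IsCompactOp B S) :
    IsCompactOp B (L ∘ₗ S) := fun ε hε => by
  obtain ⟨C, hC, hb⟩ := hL.bound
  -- `C + 1` instead of `C` guards against division by zero.
  obtain ⟨S₁, hS₁, h₁⟩ := hS (ε / (C + 1)) (by positivity)
  refine ⟨L ∘ₗ S₁, ?_, fun z => ?_⟩
  · clear h₁
    induction hS₁ using Submodule.span_induction with
    | mem R hR =>
      obtain ⟨ξ, η, h⟩ := hR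
      exact Submodule.subset_span ⟨L ξ, η, fun z => by rw [LinearMap.comp_apply, h, hL.map_smul]⟩
    | zero => rw [LinearMap.comp_zero]; exact Submodule.zero_mem _
    | add R R' _ _ h h' => rw [LinearMap.comp_add]; exact Submodule.add_mem _ h h'
    | smul c R _ h => rw [LinearMap.comp_smul]; exact Submodule.smul_mem _ c h
  · rw [LinearMap.comp_apply, LinearMap.comp_apply, ← map_sub]
    calc ‖L (S z - S₁ z)‖ ≤ C * ‖S z - S₁ z‖ := hb _
      _ ≤ (C + 1) * (ε / (C + 1) * ‖z‖) := by gcongr; exacts [by linarith, h₁ z]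
      _ = ε * ‖z‖ := by field_simp

/-- Here the adjoint is essential: $x\langle y,L\,\cdot\rangle=x\langle L^*y,\cdot\rangle$. -/
theorem comp_right {L : E'' →ₗ[ℂ] E} (hL : IsAdjointable B L) (hS : IsCompactOp B S) :
    IsCompactOp B (S ∘ₗ L) := fun ε hε => by
  obtain ⟨C, hC, hb⟩ := hL.bound
  obtain ⟨L', hL'⟩ := hL.adjoint
  obtain ⟨S₁, hS₁, h₁⟩ := hS (ε / (C + 1)) (by positivity)
  refine ⟨S₁ ∘ₗ L, ?_, fun z => ?_⟩
  · clear h₁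
    induction hS₁ using Submodule.span_induction with
    | mem R hR =>
      obtain ⟨ξ, η, h⟩ := hR
      exact Submodule.subset_span ⟨ξ, L' η, fun z => by
        rw [LinearMap.comp_apply, h, hL'.symm]⟩
    | zero => rw [LinearMap.zero_comp]; exact Submodule.zero_mem _
    | add R R' _ _ h h' => rw [LinearMap.add_comp]; exact Submodule.add_mem _ h h'
    | smul c R _ h => rw [LinearMap.smul_comp]; exact Submodule.smul_mem _ c h
  · calc ‖S (L z) - S₁ (L z)‖ ≤ ε / (C + 1) * ‖L z‖ := h₁ _
      _ ≤ ε / (C + 1) * (C * ‖z‖) := by gcongr; exact hb z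
      _ ≤ ε / (C + 1) * ((C + 1) * ‖z‖) := by gcongr; linarith
      _ = ε * ‖z‖ := by field_simp

end IsCompactOp

variable (B) in
/-- Equality of operators modulo "compact" operators. -/
def CompactEq (S R : E →ₗ[ℂ] E') : Prop := IsCompactOp B (S - R)

namespace CompactEq

variable {S R Q S' R' : E →ₗ[ℂ] E'}

theorem refl (S : E →ₗ[ℂ] E') : CompactEq B S S := by
  rw [CompactEq, sub_self]; exact .zero

theorem of_eq (h : S = R) : CompactEq B S R := h ▸ refl S

theorem symm (h : CompactEq B S R) : CompactEq B R S := by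
  rw [CompactEq, ← neg_sub]; exact h.neg

theorem trans (h : CompactEq B S R) (h' : CompactEq B R Q) : CompactEq B S Q := by
  rw [CompactEq, ← sub_add_sub_cancel S R Q]; exact IsCompactOp.add h h'

instance : Trans (CompactEq B (E := E) (E' := E')) (CompactEq B) (CompactEq B) := ⟨trans⟩

theorem add (h : CompactEq B S R) (h' : CompactEq B S' R') : CompactEq B (S + S') (R + R') := by
  rw [CompactEq, add_sub_add_comm]; exact IsCompactOp.add h h'

theorem comp_left {L : E' →ₗ[ℂ] E''} (hL : IsBoundedModuleMap B L) (h : CompactEq B S R) :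
    CompactEq B (L ∘ₗ S) (L ∘ₗ R) := by
  rw [CompactEq, ← LinearMap.comp_sub]; exact IsCompactOp.comp_left hL h

theorem comp_right {L : E'' →ₗ[ℂ] E} (hL : IsAdjointable B L) (h : CompactEq B S R) :
    CompactEq B (S ∘ₗ L) (R ∘ₗ L) := by
  rw [CompactEq, ← LinearMap.sub_comp]; exact IsCompactOp.comp_right hL h

end CompactEq

end HilbertMod

/-! ### Charts: isometric copies of $\rho[J]H$ in another module -/

variable {A : Type u} {B : Type v} [CStarAlgebra A]
  [NonUnitalCStarAlgebra B] [PartialOrder B] [StarOrderedRing B]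

/-- An isometric `(A, B)`-bilinear map `ρ[J]H → H'` whose range contains `ρ'[J]H'`. -/
structure Chart (J : TwoSidedIdeal A) (x : KTriple.{u, v, w} A B) (z : KTriple.{u, v, w'} A B) where
  ι : x.sub J →ₗ[ℂ] z.H
  π : J → z.H →ₗ[ℂ] x.sub J
  inner_map : ∀ ξ η, ⟪ι ξ, ι η⟫_B = ⟪ξ, η⟫_B
  map_act : ∀ (a : A) ξ, ι (x.act J a ξ) = z.ρ a (ι ξ)
  map_smul : ∀ (b : B) ξ, ι (b • ξ) = b • ι ξ
  ι_π : ∀ (c : J) ζ, ι (π c ζ) = z.ρ c ζ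

namespace KTriple

variable {x : KTriple.{u, v, w} A B}

theorem IsUnitalKasparov.isAdjointable_ρ (hx : x.IsUnitalKasparov) (a : A) :
    IsAdjointable B (x.ρ a) :=
  have := hx.complete
  (hx.ρ_star a).isAdjointable

theorem IsUnitalKasparov.isAdjointable_F (hx : x.IsUnitalKasparov) : IsAdjointable B x.F := by
  have := hx.complete
  obtain ⟨F', h, -⟩ := hx.adjoint
  exact h.isAdjointable

theorem IsUnitalKasparov.commute (hx : x.IsUnitalKasparov) (a : A) :
    CompactEq B (x.F ∘ₗ x.ρ a) (x.ρ a ∘ₗ x.F) := hx.commutator a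

theorem IsUnitalKasparov.sq (hx : x.IsUnitalKasparov) :
    CompactEq B (x.F ∘ₗ x.F) LinearMap.id := by
  have h := hx.sq_sub_one 1
  rwa [map_one] at h

theorem isBoundedModuleMap_subtype (J : TwoSidedIdeal A) :
    IsBoundedModuleMap B (x.sub J).subtype :=
  isBoundedModuleMap_of_inner_map (fun _ _ => rfl) (fun _ _ => rfl)

theorem isAdjointPair_actInto (hρ : ∀ a : A, IsAdjointPair B (x.ρ a) (x.ρ (star a)))
    {J : TwoSidedIdeal A} (c : J) :
    IsAdjointPair B (x.actInto J c) (x.ρ (star (c : A)) ∘ₗ (x.sub J).subtype) :=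
  fun ξ η => hρ c ξ η

theorem IsUnitalKasparov.isAdjointable_actInto (hx : x.IsUnitalKasparov) {J : TwoSidedIdeal A}
    (c : J) : IsAdjointable B (x.actInto J c) :=
  ⟨⟨_, isAdjointPair_actInto hx.ρ_star c⟩, (hx.isAdjointable_ρ c).bound⟩

/-- The operator `ρ(c)`, `c ∈ J`, restricted to `ρ[J]H`, is adjointable as a map into `H`. -/
theorem IsUnitalKasparov.isAdjointable_ρ_comp_subtype (hx : x.IsUnitalKasparov)
    {J : TwoSidedIdeal A} (hJ : J.IsClosedStar) (c : J) :
    IsAdjointable B (x.ρ c ∘ₗ (x.sub J).subtype) := by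
  -- The operator is the adjoint of `actInto` at `star c`, which is bounded.
  have h := isAdjointPair_actInto hx.ρ_star (⟨star (c : A), hJ.star_mem c c.2⟩ : J)
  rw [star_star] at h
  exact h.isAdjointable_right (hx.isAdjointable_actInto _).isBoundedModuleMap

theorem act_comp_actInto {J : TwoSidedIdeal A} (a : A) (c : J) :
    x.act J a ∘ₗ x.actInto J c = x.actInto J ⟨a * c, J.mul_mem_left _ _ c.2⟩ :=
  LinearMap.ext fun ξ => Subtype.ext (x.ρ_mul_apply a c ξ).symm

end KTriple

namespace Chart

variable {J : TwoSidedIdeal A} {x : KTriple.{u, v, w} A B} {z : KTriple.{u, v, w'} A B}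
  (κ : Chart J x z)

theorem injective : Function.Injective κ.ι := fun ξ η h => by
  refine ext_inner (B := B) fun ζ => ?_
  rw [← κ.inner_map, ← κ.inner_map, h]

/-- The operator `u ↦ ι(cu)` from `H` to `H'`. -/
def push (c : J) : x.H →ₗ[ℂ] z.H := κ.ι ∘ₗ x.actInto J c

/-- The operator `ζ ↦ cζ` from `H'` to `H`. -/
def pull (c : J) : z.H →ₗ[ℂ] x.H := (x.sub J).subtype ∘ₗ κ.π c

theorem π_ι (c : J) (ξ : x.sub J) : κ.π c (κ.ι ξ) = x.act J c ξ :=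
  κ.injective (by rw [κ.ι_π, κ.map_act])

theorem act_π (a : A) (c : J) (ζ : z.H) :
    x.act J a (κ.π c ζ) = κ.π ⟨a * c, J.mul_mem_left _ _ c.2⟩ ζ :=
  κ.injective (by rw [κ.map_act, κ.ι_π, κ.ι_π, z.ρ_mul_apply])

theorem push_comp_pull (c d : J) : κ.push c ∘ₗ κ.pull d = z.ρ (c * d) :=
  LinearMap.ext fun ζ =>
    (κ.map_act c (κ.π d ζ)).trans (by rw [κ.ι_π, z.ρ_mul_apply])

theorem pull_comp_push (c d : J) : κ.pull c ∘ₗ κ.push d = x.ρ (c * d) :=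
  LinearMap.ext fun ξ => by
    change ((κ.π c (κ.ι (x.actInto J d ξ)) : x.sub J) : x.H) = _
    rw [π_ι, x.ρ_mul_apply]
    rfl

theorem ρ_comp_push (a : A) (c : J) :
    z.ρ a ∘ₗ κ.push c = κ.push ⟨a * c, J.mul_mem_left _ _ c.2⟩ :=
  LinearMap.ext fun ξ => by
    change z.ρ a (κ.ι (x.actInto J c ξ)) = κ.ι _
    rw [← κ.map_act, ← KTriple.act_comp_actInto]
    rfl

theorem push_comp_ρ (a : A) (c : J) :
    κ.push c ∘ₗ x.ρ a = κ.push ⟨c * a, J.mul_mem_right _ _ c.2⟩ :=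
  LinearMap.ext fun ξ => congrArg κ.ι (Subtype.ext (x.ρ_mul_apply c a ξ).symm)

theorem push_add (a c : J) (d : J) (h : (d : A) = a + c) : κ.push d = κ.push a + κ.push c :=
  LinearMap.ext fun ξ => by
    refine Eq.trans (congrArg κ.ι (Subtype.ext ?_)) (map_add κ.ι (x.actInto J a ξ) (x.actInto J c ξ))
    change x.ρ d ξ = x.ρ a ξ + x.ρ c ξ
    rw [h, map_add, LinearMap.add_apply]

theorem π_add (a c : J) (d : J) (h : (d : A) = a + c) : κ.π d = κ.π a + κ.π c :=
  LinearMap.ext fun ζ => κ.injective (by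
    rw [LinearMap.add_apply, map_add, κ.ι_π, κ.ι_π, κ.ι_π, h, map_add, LinearMap.add_apply])

theorem isBoundedModuleMap_ι : IsBoundedModuleMap B κ.ι :=
  isBoundedModuleMap_of_inner_map κ.inner_map κ.map_smul

/-- $\iota$ itself may have no adjoint. For a product $ac$, however, $\rho'(a)$ moves across as
$\rho'(a^*)$, whose values lie in the range of $\iota$; the isometry removes $\iota$, and $\rho(c)$
then moves across in $H$. -/
theorem isAdjointPair_push (hJ : J.IsClosedStar)
    (hx : ∀ a : A, IsAdjointPair B (x.ρ a) (x.ρ (star a)))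
    (hz : ∀ a : A, IsAdjointPair B (z.ρ a) (z.ρ (star a))) (c : J) :
    IsAdjointPair B (κ.push c) (κ.pull ⟨star (c : A), hJ.star_mem c c.2⟩) := by
  suffices ∀ c (h : c ∈ J), IsAdjointPair B (κ.push ⟨c, h⟩) (κ.pull ⟨star c, hJ.star_mem c h⟩) from
    this c c.2
  intro c hc
  refine TwoSidedIdeal.induction_on_mul (p := fun c => ∀ h : c ∈ J,
    IsAdjointPair B (κ.push ⟨c, h⟩) (κ.pull ⟨star c, hJ.star_mem c h⟩)) hJ.isClosed hJ.star_mem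
    (fun a ha c hc pa pc h => ?_) (fun a ha c hc h => ?_) hc hc
  · have h₁ := κ.push_add ⟨a, ha⟩ ⟨c, hc⟩ ⟨a + c, h⟩ rfl
    have h₂ := κ.π_add ⟨star a, hJ.star_mem a ha⟩ ⟨star c, hJ.star_mem c hc⟩
      ⟨star (a + c), hJ.star_mem _ h⟩ (star_add a c)
    rw [h₁, pull, h₂, LinearMap.comp_add]
    exact (pa ha).add (pc hc)
  · intro ξ ζ
    have h₁ : κ.push ⟨a * c, h⟩ = z.ρ a ∘ₗ κ.push ⟨c, hc⟩ := (κ.ρ_comp_push a ⟨c, hc⟩).symm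
    have h₂ : κ.π ⟨star (a * c), hJ.star_mem _ h⟩ ζ =
        x.act J (star c) (κ.π ⟨star a, hJ.star_mem a ha⟩ ζ) := by
      rw [act_π]
      congr 2
      exact Subtype.ext (star_mul a c)
    calc ⟪κ.push ⟨a * c, h⟩ ξ, ζ⟫_B = ⟪κ.push ⟨c, hc⟩ ξ, z.ρ (star a) ζ⟫_B := by
          rw [h₁, LinearMap.comp_apply, hz]
      _ = ⟪x.actInto J ⟨c, hc⟩ ξ, κ.π ⟨star a, hJ.star_mem a ha⟩ ζ⟫_B := by
          rw [← κ.inner_map, κ.ι_π]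
          rfl
      _ = ⟪ξ, x.ρ (star c) (κ.pull ⟨star a, hJ.star_mem a ha⟩ ζ)⟫_B := hx c ξ _
      _ = _ := by rw [pull, pull, LinearMap.comp_apply, LinearMap.comp_apply, h₂]; rfl

theorem isBoundedModuleMap_push (hx : x.IsUnitalKasparov) (c : J) :
    IsBoundedModuleMap B (κ.push c) :=
  κ.isBoundedModuleMap_ι.comp (hx.isAdjointable_actInto c).isBoundedModuleMap

theorem isAdjointable_pull (hJ : J.IsClosedStar) (hx : x.IsUnitalKasparov)
    (hz : ∀ a : A, IsAdjointPair B (z.ρ a) (z.ρ (star a))) (c : J) :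
    IsAdjointable B (κ.pull c) := by
  have h := (κ.isAdjointPair_push hJ hx.ρ_star hz
    ⟨star (c : A), hJ.star_mem c c.2⟩).isAdjointable_right (κ.isBoundedModuleMap_push hx _)
  simpa only [star_star] using h

/-- For a product, $\iota(ac\,\xi)=\rho'(a)\iota(c\xi)$ visibly lies in $\rho'[J]H'$; products span
the ideal. -/
theorem ι_mem_sub (hJ : J.IsClosedStar) (ξ : x.sub J) : κ.ι ξ ∈ z.sub J := by
  suffices x.sub J ≤ ((z.sub J).comap κ.ι).map (x.sub J).subtype by
    obtain ⟨η, h, e⟩ := this ξ.2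
    rwa [← Subtype.ext e]
  refine Submodule.span_le.mpr ?_
  rintro _ ⟨a, ha, ξ, rfl⟩
  refine ⟨x.actInto J ⟨a, ha⟩ ξ, ?_, rfl⟩
  refine TwoSidedIdeal.induction_on_mul (p := fun a => ∀ h : a ∈ J, κ.push ⟨a, h⟩ ξ ∈ z.sub J)
    hJ.isClosed hJ.star_mem (fun a ha c hc pa pc h => ?_) (fun a ha c hc h => ?_) ha ha
  · rw [κ.push_add ⟨a, ha⟩ ⟨c, hc⟩ ⟨a + c, h⟩ rfl]
    exact Submodule.add_mem _ (pa ha) (pc hc)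
  · rw [← κ.ρ_comp_push a ⟨c, hc⟩]
    exact z.ρ_mem_sub ha _

/-- `ι` as a unitary isomorphism onto `ρ'[J]H'`. -/
def equiv (hJ : J.IsClosedStar) : x.sub J ≃ₗ[ℂ] z.sub J :=
  LinearEquiv.ofBijective (κ.ι.codRestrict (z.sub J) (κ.ι_mem_sub hJ)) <| by
    refine ⟨fun ξ η h => κ.injective (congrArg Subtype.val h), fun ζ => ?_⟩
    have h : z.sub J ≤ LinearMap.range κ.ι := by
      refine Submodule.span_le.mpr ?_
      rintro _ ⟨a, ha, ζ, rfl⟩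
      exact ⟨κ.π ⟨a, ha⟩ ζ, κ.ι_π _ _⟩
    obtain ⟨ξ, e⟩ := h ζ.2
    exact ⟨ξ, Subtype.ext e⟩

/-- If the operators of `x` and `z` are intertwined by the maps `u ↦ ι(cu)` up to "compact"
operators, then `x` and `z` agree on `J`. -/
def agreement (hJ : J.IsClosedStar) (hx : x.IsUnitalKasparov) (hz : z.IsUnitalKasparov)
    (h : ∀ c : J, CompactEq B (z.F ∘ₗ κ.push c) (κ.push c ∘ₗ x.F)) : Agreement J x z where
  T := κ.equiv hJ
  inner_map := κ.inner_map
  map_act a ξ := Subtype.ext (κ.map_act a ξ)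
  map_smul b ξ := Subtype.ext (κ.map_smul b ξ)
  compact c d := by
    let D : J → J → x.sub J →ₗ[ℂ] z.sub J := fun c d =>
      (κ.equiv hJ).toLinearMap ∘ₗ x.compress J c d - z.compress J c d ∘ₗ (κ.equiv hJ).toLinearMap
    have hD : ∀ (c d : J) ξ, (D c d ξ : z.H) =
        κ.ι (x.actInto J c (x.F (x.ρ d ξ))) - z.ρ c (z.F (z.ρ d (κ.ι ξ))) := fun _ _ _ => rfl
    have hpush : ∀ (d : J) (ξ : x.sub J), z.ρ d (κ.ι ξ) = κ.push d ξ := fun d ξ =>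
      (κ.map_act d ξ).symm
    -- This version lives on all of $H$, where composition with `push` is available; it remains to
    -- compress it to $\rho[J]H$.
    have key : ∀ c d : J, CompactEq B (κ.push c ∘ₗ x.F ∘ₗ x.ρ d) (z.ρ c ∘ₗ z.F ∘ₗ κ.push d) := by
      intro c d
      calc CompactEq B (κ.push c ∘ₗ x.F ∘ₗ x.ρ d) (κ.push c ∘ₗ x.ρ d ∘ₗ x.F) :=
            (hx.commute d).comp_left (κ.isBoundedModuleMap_push hx c)
        CompactEq B _ (z.ρ c ∘ₗ κ.push d ∘ₗ x.F) := .of_eq <| by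
            rw [← LinearMap.comp_assoc, ← LinearMap.comp_assoc, push_comp_ρ, ρ_comp_push]
        CompactEq B _ _ := (h d).symm.comp_left (hz.isAdjointable_ρ c).isBoundedModuleMap
    suffices ∀ c (hc : c ∈ J) d (hd : d ∈ J), IsCompactOp B (D ⟨c, hc⟩ ⟨d, hd⟩) from
      this c c.2 d d.2
    intro c hc
    refine TwoSidedIdeal.induction_on_mul (p := fun c => ∀ (hc : c ∈ J) d (hd : d ∈ J),
      IsCompactOp B (D ⟨c, hc⟩ ⟨d, hd⟩)) hJ.isClosed hJ.star_mem
      (fun a ha c hc pa pc h d hd => ?_) (fun a ha c hc h d hd => ?_) hc hc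
    · have e : D ⟨a + c, h⟩ ⟨d, hd⟩ = D ⟨a, ha⟩ ⟨d, hd⟩ + D ⟨c, hc⟩ ⟨d, hd⟩ := by
        refine LinearMap.ext fun ξ => Subtype.ext ?_
        have h₁ := LinearMap.congr_fun (κ.push_add ⟨a, ha⟩ ⟨c, hc⟩ ⟨a + c, h⟩ rfl) (x.F (x.ρ d ξ))
        rw [LinearMap.add_apply, Submodule.coe_add, hD, hD, hD]
        refine (congrArg₂ (· - ·) h₁ (by rw [map_add])).trans ?_
        simp only [LinearMap.add_apply]
        exact add_sub_add_comm _ _ _ _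
      rw [e]
      exact (pa ha d hd).add (pc hc d hd)
    · refine TwoSidedIdeal.induction_on_mul (p := fun d => ∀ (hd : d ∈ J),
        IsCompactOp B (D ⟨a * c, h⟩ ⟨d, hd⟩)) hJ.isClosed hJ.star_mem
        (fun d hd e he pd pe h' => ?_) (fun d hd e he h' => ?_) hd hd
      · have e : D ⟨a * c, h⟩ ⟨d + e, h'⟩ = D ⟨a * c, h⟩ ⟨d, hd⟩ + D ⟨a * c, h⟩ ⟨e, he⟩ := by
          refine LinearMap.ext fun ξ => Subtype.ext ?_
          rw [LinearMap.add_apply, Submodule.coe_add, hD, hD, hD]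
          simp only [map_add, LinearMap.add_apply]
          exact add_sub_add_comm _ _ _ _
        rw [e]
        exact (pd hd).add (pe he)
      -- The outer factors do the compression: `a` maps $H'$ into $\rho'[J]H'$, and `e` turns the
      -- inclusion of $\rho[J]H$ into an adjointable map.
      · have hD' : D ⟨a * c, h⟩ ⟨d * e, h'⟩ = z.actInto J ⟨a, ha⟩ ∘ₗ
            (κ.push ⟨c, hc⟩ ∘ₗ x.F ∘ₗ x.ρ d - z.ρ c ∘ₗ z.F ∘ₗ κ.push ⟨d, hd⟩) ∘ₗ
              (x.ρ e ∘ₗ (x.sub J).subtype) := by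
          refine LinearMap.ext fun ξ => Subtype.ext ?_
          rw [hD]
          change _ = z.ρ a (κ.push ⟨c, hc⟩ (x.F (x.ρ d (x.ρ e ξ))) -
            z.ρ c (z.F (κ.push ⟨d, hd⟩ (x.ρ e ξ))))
          have h₁ := LinearMap.congr_fun (κ.ρ_comp_push a ⟨c, hc⟩) (x.F (x.ρ (d * e) ξ))
          rw [hpush, map_sub, ← x.ρ_mul_apply, ← z.ρ_mul_apply]
          refine congrArg₂ (· - ·) h₁.symm ?_
          exact congrArg (fun t => z.ρ (a * c) (z.F t))
            (LinearMap.congr_fun (κ.push_comp_ρ e ⟨d, hd⟩) (ξ : x.H)).symm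
        rw [hD']
        exact IsCompactOp.comp_left (hz.isAdjointable_actInto _).isBoundedModuleMap
          (IsCompactOp.comp_right (hx.isAdjointable_ρ_comp_subtype hJ ⟨e, he⟩)
            (key ⟨c, hc⟩ ⟨d, hd⟩))

end Chart

/-! ### Gluing operators along two charts -/

/-- Two charts of `z` whose transition operators intertwine the operators of `x` and `y` up to
"compact" operators. -/
structure Gluing (J₁ J₂ : TwoSidedIdeal A) (x : KTriple.{u, v, w} A B) (y : KTriple.{u, v, w'} A B)
    (z : KTriple.{u, v, w''} A B) where
  chart₁ : Chart J₁ x z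
  chart₂ : Chart J₂ y z
  isClosedStar₁ : J₁.IsClosedStar
  isClosedStar₂ : J₂.IsClosedStar
  kasparov₁ : x.IsUnitalKasparov
  kasparov₂ : y.IsUnitalKasparov
  ρ_star : ∀ a : A, IsAdjointPair B (z.ρ a) (z.ρ (star a))
  transition₁ : ∀ (c : J₁) (d : J₂), CompactEq B (y.F ∘ₗ chart₂.pull d ∘ₗ chart₁.push c)
    ((chart₂.pull d ∘ₗ chart₁.push c) ∘ₗ x.F)
  transition₂ : ∀ (c : J₁) (d : J₂), CompactEq B (x.F ∘ₗ chart₁.pull c ∘ₗ chart₂.push d)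
    ((chart₁.pull c ∘ₗ chart₂.push d) ∘ₗ y.F)

namespace Gluing

variable {J₁ J₂ : TwoSidedIdeal A} {x : KTriple.{u, v, w} A B} {y : KTriple.{u, v, w'} A B}
  {z : KTriple.{u, v, w''} A B} (g : Gluing J₁ J₂ x y z)

/-- The gluing with the two charts interchanged. -/
def swap : Gluing J₂ J₁ y x z where
  chart₁ := g.chart₂
  chart₂ := g.chart₁
  isClosedStar₁ := g.isClosedStar₂
  isClosedStar₂ := g.isClosedStar₁
  kasparov₁ := g.kasparov₂
  kasparov₂ := g.kasparov₁
  ρ_star := g.ρ_star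
  transition₁ c d := g.transition₂ d c
  transition₂ c d := g.transition₁ d c

/-- The operator `ψ₁Sψ₁ + ψ₂Rψ₂` glued from `S` and `R`. -/
def op (p₁ : J₁) (p₂ : J₂) (S : x.H →ₗ[ℂ] x.H) (R : y.H →ₗ[ℂ] y.H) : z.H →ₗ[ℂ] z.H :=
  g.chart₁.push p₁ ∘ₗ S ∘ₗ g.chart₁.pull p₁ + g.chart₂.push p₂ ∘ₗ R ∘ₗ g.chart₂.pull p₂

theorem swap_op (p₁ : J₁) (p₂ : J₂) (S : x.H →ₗ[ℂ] x.H) (R : y.H →ₗ[ℂ] y.H) :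
    g.swap.op p₂ p₁ R S = g.op p₁ p₂ S R := add_comm _ _

theorem op_id {p₁ : J₁} {p₂ : J₂} (hp : (p₁ : A) * p₁ + (p₂ : A) * p₂ = 1) :
    g.op p₁ p₂ LinearMap.id LinearMap.id = LinearMap.id := by
  rw [op, LinearMap.id_comp, LinearMap.id_comp, Chart.push_comp_pull, Chart.push_comp_pull,
    ← map_add, hp, map_one]
  rfl

theorem comp_op {E : Type*} [AddCommGroup E] [Module ℂ E] (L : z.H →ₗ[ℂ] E) (p₁ : J₁) (p₂ : J₂)
    (S : x.H →ₗ[ℂ] x.H) (R : y.H →ₗ[ℂ] y.H) :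
    L ∘ₗ g.op p₁ p₂ S R = ((L ∘ₗ g.chart₁.push p₁) ∘ₗ S) ∘ₗ g.chart₁.pull p₁ +
      ((L ∘ₗ g.chart₂.push p₂) ∘ₗ R) ∘ₗ g.chart₂.pull p₂ :=
  LinearMap.comp_add _ _ _

/-- Localization: an operator on the glued module is recovered from its composites with the two
pushes, so a relation modulo "compacts" need only be checked there. -/
theorem comp_push_pull_add {E : Type*} [AddCommGroup E] [Module ℂ E] (L : z.H →ₗ[ℂ] E)
    {p₁ : J₁} {p₂ : J₂} (hp : (p₁ : A) * p₁ + (p₂ : A) * p₂ = 1) :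
    (L ∘ₗ g.chart₁.push p₁) ∘ₗ g.chart₁.pull p₁ + (L ∘ₗ g.chart₂.push p₂) ∘ₗ g.chart₂.pull p₂ =
      L := by
  have h := g.comp_op L p₁ p₂ LinearMap.id LinearMap.id
  rw [g.op_id hp, LinearMap.comp_id, LinearMap.comp_id, LinearMap.comp_id] at h
  exact h.symm

theorem isBoundedModuleMap_push₁ (c : J₁) : IsBoundedModuleMap B (g.chart₁.push c) :=
  g.chart₁.isBoundedModuleMap_push g.kasparov₁ c

theorem isAdjointable_pull₁ (c : J₁) : IsAdjointable B (g.chart₁.pull c) :=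
  g.chart₁.isAdjointable_pull g.isClosedStar₁ g.kasparov₁ g.ρ_star c

theorem op_congr {p₁ : J₁} {p₂ : J₂} {S S' : x.H →ₗ[ℂ] x.H} {R R' : y.H →ₗ[ℂ] y.H}
    (hS : CompactEq B S S') (hR : CompactEq B R R') :
    CompactEq B (g.op p₁ p₂ S R) (g.op p₁ p₂ S' R') :=
  .add ((hS.comp_right (g.isAdjointable_pull₁ p₁)).comp_left (g.isBoundedModuleMap_push₁ p₁))
    ((hR.comp_right (g.swap.isAdjointable_pull₁ p₂)).comp_left (g.swap.isBoundedModuleMap_push₁ p₂))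

variable {p₁ : J₁} {p₂ : J₂}

/-- In each summand the pull meets the push, giving $\rho(p_1c)$ or a transition operator. Either
lets $F$ through to the right, and the partition of unity then collapses what remains on the left.
-/
theorem op_comp_push₁ (hp : (p₁ : A) * p₁ + (p₂ : A) * p₂ = 1) (c : J₁) :
    CompactEq B (g.op p₁ p₂ x.F y.F ∘ₗ g.chart₁.push c) (g.chart₁.push c ∘ₗ x.F) := by
  have h : CompactEq B (x.F ∘ₗ g.chart₁.pull p₁ ∘ₗ g.chart₁.push c)
      ((g.chart₁.pull p₁ ∘ₗ g.chart₁.push c) ∘ₗ x.F) := by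
    rw [Chart.pull_comp_push]
    exact g.kasparov₁.commute _
  calc CompactEq B (g.op p₁ p₂ x.F y.F ∘ₗ g.chart₁.push c)
        (g.chart₁.push p₁ ∘ₗ (x.F ∘ₗ g.chart₁.pull p₁ ∘ₗ g.chart₁.push c) +
          g.chart₂.push p₂ ∘ₗ (y.F ∘ₗ g.chart₂.pull p₂ ∘ₗ g.chart₁.push c)) := .of_eq rfl
    CompactEq B _ (g.chart₁.push p₁ ∘ₗ ((g.chart₁.pull p₁ ∘ₗ g.chart₁.push c) ∘ₗ x.F) +
          g.chart₂.push p₂ ∘ₗ ((g.chart₂.pull p₂ ∘ₗ g.chart₁.push c) ∘ₗ x.F)) :=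
      .add (h.comp_left (g.isBoundedModuleMap_push₁ p₁))
        ((g.transition₁ c p₂).comp_left (g.swap.isBoundedModuleMap_push₁ p₂))
    CompactEq B _ (g.op p₁ p₂ LinearMap.id LinearMap.id ∘ₗ g.chart₁.push c ∘ₗ x.F) := .of_eq rfl
    CompactEq B _ _ := .of_eq (by rw [g.op_id hp, LinearMap.id_comp])

theorem pull_comp_op₁ (hp : (p₁ : A) * p₁ + (p₂ : A) * p₂ = 1) (c : J₁) :
    CompactEq B (g.chart₁.pull c ∘ₗ g.op p₁ p₂ x.F y.F) (x.F ∘ₗ g.chart₁.pull c) := by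
  have h : CompactEq B (x.F ∘ₗ g.chart₁.pull c ∘ₗ g.chart₁.push p₁)
      ((g.chart₁.pull c ∘ₗ g.chart₁.push p₁) ∘ₗ x.F) := by
    rw [Chart.pull_comp_push]
    exact g.kasparov₁.commute _
  rw [comp_op]
  refine .trans (.add (h.symm.comp_right (g.isAdjointable_pull₁ p₁))
    ((g.transition₂ c p₂).symm.comp_right (g.swap.isAdjointable_pull₁ p₂))) (.of_eq ?_)
  exact g.comp_push_pull_add (x.F ∘ₗ g.chart₁.pull c) hp

theorem op_comp_push₂ (hp : (p₁ : A) * p₁ + (p₂ : A) * p₂ = 1) (c : J₂) :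
    CompactEq B (g.op p₁ p₂ x.F y.F ∘ₗ g.chart₂.push c) (g.chart₂.push c ∘ₗ y.F) := by
  rw [← swap_op]
  exact g.swap.op_comp_push₁ (by rwa [add_comm]) c

theorem pull_comp_op₂ (hp : (p₁ : A) * p₁ + (p₂ : A) * p₂ = 1) (c : J₂) :
    CompactEq B (g.chart₂.pull c ∘ₗ g.op p₁ p₂ x.F y.F) (y.F ∘ₗ g.chart₂.pull c) := by
  rw [← swap_op]
  exact g.swap.pull_comp_op₁ (by rwa [add_comm]) c

/-- Up to "compact" operators, the glued operator does not depend on the partition. -/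
theorem op_compactEq_op {q₁ : J₁} {q₂ : J₂} (hp : (p₁ : A) * p₁ + (p₂ : A) * p₂ = 1)
    (hq : (q₁ : A) * q₁ + (q₂ : A) * q₂ = 1) :
    CompactEq B (g.op p₁ p₂ x.F y.F) (g.op q₁ q₂ x.F y.F) :=
  -- Localize with the second partition and let the operator built from the first pass each push.
  .trans (.of_eq (g.comp_push_pull_add (g.op p₁ p₂ x.F y.F) hq).symm)
    (.add ((g.op_comp_push₁ hp q₁).comp_right (g.isAdjointable_pull₁ q₁))
      ((g.op_comp_push₂ hp q₂).comp_right (g.swap.isAdjointable_pull₁ q₂)))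

theorem commute_op (hp : (p₁ : A) * p₁ + (p₂ : A) * p₂ = 1) (a : A) :
    CompactEq B (g.op p₁ p₂ x.F y.F ∘ₗ z.ρ a) (z.ρ a ∘ₗ g.op p₁ p₂ x.F y.F) := by
  have h₁ := g.op_comp_push₁ hp ⟨a * p₁, J₁.mul_mem_left _ _ p₁.2⟩
  have h₂ := g.op_comp_push₂ hp ⟨a * p₂, J₂.mul_mem_left _ _ p₂.2⟩
  -- Pushing along $ap_i$ is pushing along $p_i$ followed by $a$, so intertwining for $ap_i$ also
  -- moves the operator past $a$.
  rw [← Chart.ρ_comp_push] at h₁ h₂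
  rw [comp_op, ← g.comp_push_pull_add (g.op p₁ p₂ x.F y.F ∘ₗ z.ρ a) hp]
  exact .add (h₁.comp_right (g.isAdjointable_pull₁ p₁))
    (h₂.comp_right (g.swap.isAdjointable_pull₁ p₂))

/-- Moving the right-hand factor through the pulls replaces the square by the gluing of $F^2$ and
$\widetilde F^2$, hence by the gluing of the identities. -/
theorem op_comp_op (hp : (p₁ : A) * p₁ + (p₂ : A) * p₂ = 1) :
    CompactEq B (g.op p₁ p₂ x.F y.F ∘ₗ g.op p₁ p₂ x.F y.F) LinearMap.id :=
  calc CompactEq B (g.op p₁ p₂ x.F y.F ∘ₗ g.op p₁ p₂ x.F y.F)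
        (g.chart₁.push p₁ ∘ₗ x.F ∘ₗ (g.chart₁.pull p₁ ∘ₗ g.op p₁ p₂ x.F y.F) +
          g.chart₂.push p₂ ∘ₗ y.F ∘ₗ (g.chart₂.pull p₂ ∘ₗ g.op p₁ p₂ x.F y.F)) := .of_eq rfl
    CompactEq B _ (g.op p₁ p₂ (x.F ∘ₗ x.F) (y.F ∘ₗ y.F)) :=
      .add (((g.pull_comp_op₁ hp p₁).comp_left
          g.kasparov₁.isAdjointable_F.isBoundedModuleMap).comp_left (g.isBoundedModuleMap_push₁ p₁))
        (((g.pull_comp_op₂ hp p₂).comp_left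
          g.kasparov₂.isAdjointable_F.isBoundedModuleMap).comp_left
            (g.swap.isBoundedModuleMap_push₁ p₂))
    CompactEq B _ (g.op p₁ p₂ LinearMap.id LinearMap.id) := g.op_congr g.kasparov₁.sq g.kasparov₂.sq
    CompactEq B _ _ := .of_eq (g.op_id hp)

theorem isAdjointPair_push₁ (hp₁ : star (p₁ : A) = p₁) :
    IsAdjointPair B (g.chart₁.push p₁) (g.chart₁.pull p₁) := by
  have h := g.chart₁.isAdjointPair_push g.isClosedStar₁ g.kasparov₁.ρ_star g.ρ_star p₁
  rwa [Subtype.ext (a1 := ⟨star (p₁ : A), _⟩) (a2 := p₁) hp₁] at h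

theorem isAdjointPair_op (hp₁ : star (p₁ : A) = p₁) (hp₂ : star (p₂ : A) = p₂)
    {S S' : x.H →ₗ[ℂ] x.H} {R R' : y.H →ₗ[ℂ] y.H} (hS : IsAdjointPair B S S')
    (hR : IsAdjointPair B R R') : IsAdjointPair B (g.op p₁ p₂ S R) (g.op p₁ p₂ S' R') :=
  have h₁ := g.isAdjointPair_push₁ hp₁
  have h₂ := g.swap.isAdjointPair_push₁ hp₂
  (h₁.comp (hS.comp h₁.symm)).add (h₂.comp (hR.comp h₂.symm))

theorem push_pull_add (hp : (p₁ : A) * p₁ + (p₂ : A) * p₂ = 1) (ζ : z.H) :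
    g.chart₁.push p₁ (g.chart₁.pull p₁ ζ) + g.chart₂.push p₂ (g.chart₂.pull p₂ ζ) = ζ :=
  LinearMap.congr_fun (g.op_id hp) ζ

/-- The two pulls are bounded coordinates in complete modules, and the two pushes rebuild a vector
from them continuously. -/
theorem completeSpace (g : Gluing J₁ J₂ x y z) (hp : (p₁ : A) * p₁ + (p₂ : A) * p₂ = 1) : CompleteSpace z.H := by
  have := g.kasparov₁.complete
  have := g.kasparov₂.complete
  obtain ⟨C₁, hC₁⟩ := (g.isAdjointable_pull₁ p₁).bound
  obtain ⟨C₂, hC₂⟩ := (g.swap.isAdjointable_pull₁ p₂).bound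
  obtain ⟨D₁, hD₁⟩ := (g.isBoundedModuleMap_push₁ p₁).bound
  obtain ⟨D₂, hD₂⟩ := (g.swap.isBoundedModuleMap_push₁ p₂).bound
  let Q₁ : z.H →L[ℂ] x.H := (g.chart₁.pull p₁).mkContinuous C₁ hC₁.2
  let Q₂ : z.H →L[ℂ] y.H := (g.chart₂.pull p₂).mkContinuous C₂ hC₂.2
  let P₁ : x.H →L[ℂ] z.H := (g.chart₁.push p₁).mkContinuous D₁ hD₁.2
  let P₂ : y.H →L[ℂ] z.H := (g.chart₂.push p₂).mkContinuous D₂ hD₂.2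
  refine Metric.complete_of_cauchySeq_tendsto fun ζ hζ => ?_
  obtain ⟨ξ, hξ⟩ := cauchySeq_tendsto_of_complete (Q₁.uniformContinuous.comp_cauchySeq hζ)
  obtain ⟨η, hη⟩ := cauchySeq_tendsto_of_complete (Q₂.uniformContinuous.comp_cauchySeq hζ)
  refine ⟨P₁ ξ + P₂ η, ?_⟩
  refine (((P₁.continuous.tendsto ξ).comp hξ).add ((P₂.continuous.tendsto η).comp hη)).congr
    fun n => ?_
  exact g.push_pull_add hp (ζ n)

theorem isUnitalKasparov (g : Gluing J₁ J₂ x y z) (hp : (p₁ : A) * p₁ + (p₂ : A) * p₂ = 1) (hp₁ : star (p₁ : A) = p₁)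
    (hp₂ : star (p₂ : A) = p₂) (hF : z.F = g.op p₁ p₂ x.F y.F) : z.IsUnitalKasparov := by
  -- Completeness comes first, since boundedness of the action is taken from the closed graph
  -- theorem.
  have hc := g.completeSpace hp
  have hρ : ∀ a, IsAdjointable B (z.ρ a) := fun a => (g.ρ_star a).isAdjointable
  refine ⟨hc, g.ρ_star, fun a => ?_, fun a => ?_, ?_⟩
  · rw [hF]
    exact g.commute_op hp a
  · rw [hF]
    exact IsCompactOp.comp_left (hρ a).isBoundedModuleMap (g.op_comp_op hp)
  · obtain ⟨S, hS, hS'⟩ := g.kasparov₁.adjoint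
    obtain ⟨R, hR, hR'⟩ := g.kasparov₂.adjoint
    have hxS : CompactEq B x.F S := by
      have h := hS' 1
      rwa [map_one] at h
    have hyR : CompactEq B y.F R := by
      have h := hR' 1
      rwa [map_one] at h
    refine ⟨g.op p₁ p₂ S R, hF ▸ g.isAdjointPair_op hp₁ hp₂ hS hR, fun a => ?_⟩
    rw [hF]
    exact IsCompactOp.comp_left (hρ a).isBoundedModuleMap (g.op_congr hxS hyR)

end Gluing

/-! ### Transfer operators of an agreement -/

namespace Agreement

variable {J : TwoSidedIdeal A} {x : KTriple.{u, v, w} A B} {y : KTriple.{u, v, w'} A B}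

theorem inner_symm_map (T : Agreement J x y) (ξ : y.sub J) (η : y.sub J) :
    ⟪T.T.symm ξ, T.T.symm η⟫_B = ⟪ξ, η⟫_B := by
  rw [← T.inner_map, T.T.apply_symm_apply, T.T.apply_symm_apply]

theorem symm_map_act (T : Agreement J x y) (a : A) (η : y.sub J) :
    T.T.symm (y.act J a η) = x.act J a (T.T.symm η) := by
  rw [LinearEquiv.symm_apply_eq, T.map_act, T.T.apply_symm_apply]

theorem symm_map_smul (T : Agreement J x y) (b : B) (η : y.sub J) :
    T.T.symm (b • η) = b • T.T.symm η := by
  rw [LinearEquiv.symm_apply_eq, T.map_smul, T.T.apply_symm_apply]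

theorem isAdjointPair (T : Agreement J x y) :
    IsAdjointPair B T.T.toLinearMap T.T.symm.toLinearMap := fun ξ η => by
  change ⟪T.T ξ, η⟫_B = ⟪ξ, T.T.symm η⟫_B
  rw [← T.inner_map, T.T.apply_symm_apply]

theorem isBoundedModuleMap (T : Agreement J x y) : IsBoundedModuleMap B T.T.toLinearMap :=
  isBoundedModuleMap_of_inner_map T.inner_map T.map_smul

/-- The inverse agreement. -/
def symm (T : Agreement J x y) : Agreement J y x where
  T := T.T.symm
  inner_map := T.inner_symm_map
  map_act := T.symm_map_act
  map_smul := T.symm_map_smul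
  compact c d := by
    -- $T^{-1}(TX-YT)T^{-1}=XT^{-1}-T^{-1}Y$; the sign is corrected by the final `neg`.
    have h := ((IsCompactOp.comp_right (T.isAdjointPair.isAdjointable_right T.isBoundedModuleMap)
      (T.compact c d)).comp_left
        (isBoundedModuleMap_of_inner_map (S := T.T.symm.toLinearMap) T.inner_symm_map
          T.symm_map_smul)).neg
    refine Eq.mp (congrArg _ (LinearMap.ext fun ξ => ?_)) h
    simp

/-- The operator `u ↦ T(cu)` from `H` to `H'`. -/
def transfer (T : Agreement J x y) (c : J) : x.H →ₗ[ℂ] y.H :=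
  (y.sub J).subtype ∘ₗ T.T.toLinearMap ∘ₗ x.actInto J c

theorem transfer_add (T : Agreement J x y) (a c : J) (d : J) (h : (d : A) = a + c) :
    T.transfer d = T.transfer a + T.transfer c := by
  have : x.actInto J d = x.actInto J a + x.actInto J c :=
    LinearMap.ext fun ξ => Subtype.ext <| by
      change x.ρ d ξ = x.ρ a ξ + x.ρ c ξ
      rw [h, map_add, LinearMap.add_apply]
  rw [transfer, this, LinearMap.comp_add, LinearMap.comp_add]
  rfl

theorem transfer_comp_ρ (T : Agreement J x y) (a : A) (c : J) :
    T.transfer c ∘ₗ x.ρ a = T.transfer ⟨c * a, J.mul_mem_right _ _ c.2⟩ :=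
  LinearMap.ext fun ξ => congrArg (fun t => (T.T t : y.H)) (Subtype.ext (x.ρ_mul_apply c a ξ).symm)

theorem ρ_comp_transfer (T : Agreement J x y) (a : A) (c : J) :
    y.ρ a ∘ₗ T.transfer c = T.transfer ⟨a * c, J.mul_mem_left _ _ c.2⟩ :=
  LinearMap.ext fun ξ => by
    refine (congrArg Subtype.val (T.map_act a (x.actInto J c ξ))).symm.trans ?_
    rw [← LinearMap.comp_apply, KTriple.act_comp_actInto]
    rfl

theorem isAdjointPair_transfer (T : Agreement J x y) (hJ : J.IsClosedStar)
    (hx : ∀ a : A, IsAdjointPair B (x.ρ a) (x.ρ (star a)))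
    (hy : ∀ a : A, IsAdjointPair B (y.ρ a) (y.ρ (star a))) (c : J) :
    IsAdjointPair B (T.transfer c) (T.symm.transfer ⟨star (c : A), hJ.star_mem c c.2⟩) := by
  suffices ∀ c (h : c ∈ J), IsAdjointPair B (T.transfer ⟨c, h⟩)
      (T.symm.transfer ⟨star c, hJ.star_mem c h⟩) from this c c.2
  intro c hc
  refine TwoSidedIdeal.induction_on_mul (p := fun c => ∀ h : c ∈ J, IsAdjointPair B
    (T.transfer ⟨c, h⟩) (T.symm.transfer ⟨star c, hJ.star_mem c h⟩)) hJ.isClosed hJ.star_mem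
    (fun a ha c hc pa pc h => ?_) (fun a ha c hc h => ?_) hc hc
  · rw [T.transfer_add ⟨a, ha⟩ ⟨c, hc⟩ ⟨a + c, h⟩ rfl,
      T.symm.transfer_add ⟨star a, hJ.star_mem a ha⟩ ⟨star c, hJ.star_mem c hc⟩
      ⟨star (a + c), hJ.star_mem _ h⟩ (star_add a c)]
    exact (pa ha).add (pc hc)
  · intro ξ η
    have h₁ : T.transfer ⟨a * c, h⟩ = y.ρ a ∘ₗ T.transfer ⟨c, hc⟩ :=
      (T.ρ_comp_transfer a ⟨c, hc⟩).symm
    have h₂ : T.symm.transfer ⟨star (a * c), hJ.star_mem _ h⟩ =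
        x.ρ (star c) ∘ₗ T.symm.transfer ⟨star a, hJ.star_mem a ha⟩ := by
      rw [ρ_comp_transfer]
      congr 1
      exact Subtype.ext (star_mul a c)
    rw [h₁, h₂]
    calc ⟪y.ρ a (T.transfer ⟨c, hc⟩ ξ), η⟫_B
        = ⟪T.T (x.actInto J ⟨c, hc⟩ ξ), y.actInto J ⟨star a, hJ.star_mem a ha⟩ η⟫_B := hy a _ _
      _ = ⟪x.actInto J ⟨c, hc⟩ ξ, T.T.symm (y.actInto J ⟨star a, hJ.star_mem a ha⟩ η)⟫_B :=
          T.isAdjointPair _ _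
      _ = _ := hx c _ _

theorem isAdjointable_transfer (T : Agreement J x y) (hJ : J.IsClosedStar)
    (hx : x.IsUnitalKasparov) (hy : y.IsUnitalKasparov) (c : J) :
    IsAdjointable B (T.transfer c) :=
  have := hx.complete
  have := hy.complete
  (T.isAdjointPair_transfer hJ hx.ρ_star hy.ρ_star c).isAdjointable

/-- For a triple product $a(de)$, modulo "compacts", $\widetilde F$ passes $a$; the agreement for
the pair $(a,d)$ moves $T$ across to the left; then $F$ passes $de$. The third factor $e$ brings
vectors of $H$ into $\rho[J]H$, where the agreement applies. -/
theorem transfer_compactEq (T : Agreement J x y) (hJ : J.IsClosedStar)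
    (hx : x.IsUnitalKasparov) (hy : y.IsUnitalKasparov) (c : J) :
    CompactEq B (y.F ∘ₗ T.transfer c) (T.transfer c ∘ₗ x.F) := by
  have hadd : ∀ a (ha : a ∈ J) c (hc : c ∈ J) (h : a + c ∈ J),
      CompactEq B (y.F ∘ₗ T.transfer ⟨a, ha⟩) (T.transfer ⟨a, ha⟩ ∘ₗ x.F) →
      CompactEq B (y.F ∘ₗ T.transfer ⟨c, hc⟩) (T.transfer ⟨c, hc⟩ ∘ₗ x.F) →
      CompactEq B (y.F ∘ₗ T.transfer ⟨a + c, h⟩) (T.transfer ⟨a + c, h⟩ ∘ₗ x.F) := by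
    intro a ha c hc h pa pc
    rw [T.transfer_add ⟨a, ha⟩ ⟨c, hc⟩ ⟨a + c, h⟩ rfl, LinearMap.comp_add, LinearMap.add_comp]
    exact pa.add pc
  suffices ∀ c (h : c ∈ J), CompactEq B (y.F ∘ₗ T.transfer ⟨c, h⟩) (T.transfer ⟨c, h⟩ ∘ₗ x.F) from
    this c c.2
  intro c hc
  refine TwoSidedIdeal.induction_on_mul (p := fun c => ∀ h : c ∈ J,
    CompactEq B (y.F ∘ₗ T.transfer ⟨c, h⟩) (T.transfer ⟨c, h⟩ ∘ₗ x.F)) hJ.isClosed hJ.star_mem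
    (fun a ha c hc pa pc h => hadd a ha c hc h (pa ha) (pc hc)) (fun a ha c hc => ?_) hc hc
  -- A second factorization, of the right factor, produces the triple product.
  refine TwoSidedIdeal.induction_on_mul (p := fun c => ∀ h : a * c ∈ J,
    CompactEq B (y.F ∘ₗ T.transfer ⟨a * c, h⟩) (T.transfer ⟨a * c, h⟩ ∘ₗ x.F))
    hJ.isClosed hJ.star_mem (fun d hd e he pd pe => ?_) (fun d hd e he h => ?_) hc
  · rw [mul_add]
    exact fun h => hadd _ (J.mul_mem_left _ _ hd) _ (J.mul_mem_left _ _ he) h (pd _) (pe _)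
  · have hL : IsBoundedModuleMap B (T.transfer ⟨a, ha⟩) :=
      (T.isAdjointable_transfer hJ hx hy _).isBoundedModuleMap
    have hW : y.ρ a ∘ₗ y.ρ d ∘ₗ T.transfer ⟨e, he⟩ = T.transfer ⟨a * (d * e), h⟩ := by
      rw [ρ_comp_transfer, ρ_comp_transfer]
    have hW' : T.transfer ⟨a, ha⟩ ∘ₗ x.ρ (d * e) = T.transfer ⟨a * (d * e), h⟩ :=
      T.transfer_comp_ρ _ _
    have key : CompactEq B (T.transfer ⟨a, ha⟩ ∘ₗ x.F ∘ₗ x.ρ (d * e))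
        ((y.ρ a ∘ₗ y.F) ∘ₗ y.ρ d ∘ₗ T.transfer ⟨e, he⟩) := by
      have h := (IsCompactOp.comp_right (hx.isAdjointable_actInto (J := J) ⟨e, he⟩)
        (T.compact ⟨a, ha⟩ ⟨d, hd⟩)).comp_left (y.isBoundedModuleMap_subtype J)
      refine Eq.mp (congrArg (IsCompactOp B) (LinearMap.ext fun ξ => ?_)) h
      rw [LinearMap.sub_apply]
      change _ = (T.transfer ⟨a, ha⟩ (x.F (x.ρ (d * e) ξ))) - _
      rw [x.ρ_mul_apply]
      rfl
    calc CompactEq B (y.F ∘ₗ T.transfer ⟨a * (d * e), h⟩)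
          ((y.F ∘ₗ y.ρ a) ∘ₗ y.ρ d ∘ₗ T.transfer ⟨e, he⟩) := .of_eq (by rw [← hW]; rfl)
      CompactEq B _ ((y.ρ a ∘ₗ y.F) ∘ₗ y.ρ d ∘ₗ T.transfer ⟨e, he⟩) :=
        (hy.commute a).comp_right
          ((hy.isAdjointable_ρ d).comp (T.isAdjointable_transfer hJ hx hy _))
      CompactEq B _ (T.transfer ⟨a, ha⟩ ∘ₗ x.F ∘ₗ x.ρ (d * e)) := key.symm
      CompactEq B _ (T.transfer ⟨a, ha⟩ ∘ₗ x.ρ (d * e) ∘ₗ x.F) := (hx.commute _).comp_left hL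
      CompactEq B _ _ := .of_eq (by rw [← hW']; rfl)

end Agreement

theorem TwoSidedIdeal.IsClosedStar.inf {J₁ J₂ : TwoSidedIdeal A} (h₁ : J₁.IsClosedStar)
    (h₂ : J₂.IsClosedStar) : (J₁ ⊓ J₂).IsClosedStar where
  isClosed := by
    have : ((J₁ ⊓ J₂ : TwoSidedIdeal A) : Set A) = (J₁ : Set A) ∩ J₂ :=
      Set.ext fun _ => TwoSidedIdeal.mem_inf A
    rw [this]
    exact h₁.isClosed.inter h₂.isClosed
  star_mem a ha := by
    rw [TwoSidedIdeal.mem_inf] at ha ⊢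
    exact ⟨h₁.star_mem a ha.1, h₂.star_mem a ha.2⟩

/-! ### The mixed pairing between the two pieces -/

namespace Agreement

variable {J₁ J₂ : TwoSidedIdeal A} {x : KTriple.{u, v, w} A B} {y : KTriple.{u, v, w'} A B}
  (T : Agreement (J₁ ⊓ J₂) x y)

theorem toLeft_ι₁ (φ : J₁) (ξ : x.sub J₁) : T.toLeft φ (T.ι₁ ξ) = x.act J₁ φ ξ := by
  rw [ι₁, LinearMap.comp_apply, LinearMap.inl_apply, toLeft_cls, map_zero, map_zero, map_zero,
    add_zero]

theorem toLeft_ι₂ (φ : J₁) (η : y.sub J₂) :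
    T.toLeft φ (T.ι₂ η) = incl₁ J₁ J₂ x (T.T.symm (y.actInf₁ J₁ J₂ φ η)) := by
  rw [ι₂, LinearMap.comp_apply, LinearMap.inr_apply, toLeft_cls, map_zero, zero_add]

theorem toRight_ι₁ (φ : J₂) (ξ : x.sub J₁) :
    T.toRight φ (T.ι₁ ξ) = incl₂ J₁ J₂ y (T.T (x.actInf₂ J₁ J₂ φ ξ)) := by
  rw [ι₁, LinearMap.comp_apply, LinearMap.inl_apply, toRight_cls, map_zero, add_zero]

theorem toRight_ι₂ (φ : J₂) (η : y.sub J₂) : T.toRight φ (T.ι₂ η) = y.act J₂ φ η := by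
  rw [ι₂, LinearMap.comp_apply, LinearMap.inr_apply, toRight_cls, map_zero, map_zero, map_zero,
    zero_add]

theorem gluedAct_ι₁ (a : A) (ξ : x.sub J₁) : T.gluedAct a (T.ι₁ ξ) = T.ι₁ (x.act J₁ a ξ) := by
  rw [ι₁, LinearMap.comp_apply, LinearMap.inl_apply, gluedAct_cls, map_zero]
  rfl

theorem gluedAct_ι₂ (a : A) (η : y.sub J₂) : T.gluedAct a (T.ι₂ η) = T.ι₂ (y.act J₂ a η) := by
  rw [ι₂, LinearMap.comp_apply, LinearMap.inr_apply, gluedAct_cls, map_zero]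
  rfl

theorem smul_ι₁ (b : B) (ξ : x.sub J₁) : T.ι₁ (b • ξ) = b • T.ι₁ ξ := by
  rw [ι₁, LinearMap.comp_apply, LinearMap.comp_apply, LinearMap.inl_apply, LinearMap.inl_apply,
    smul_cls, op_smul_zero]

theorem smul_ι₂ (b : B) (η : y.sub J₂) : T.ι₂ (b • η) = b • T.ι₂ η := by
  rw [ι₂, LinearMap.comp_apply, LinearMap.comp_apply, LinearMap.inr_apply, LinearMap.inr_apply,
    smul_cls, op_smul_zero]

/-- The inner product `⟨ξ, T*(φ₁η)⟩ + ⟨T(φ₂ξ), η⟩`. -/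
def pairing (ξ : x.sub J₁) (η : y.sub J₂) (φ₁ : J₁) (φ₂ : J₂) : B :=
  ⟪(ξ : x.H), (T.T.symm (y.actInf₁ J₁ J₂ φ₁ η) : x.H)⟫_B +
    ⟪(T.T (x.actInf₂ J₁ J₂ φ₂ ξ) : y.H), (η : y.H)⟫_B

theorem actInf₁_add (a b c : J₁) (h : (c : A) = a + b) :
    y.actInf₁ J₁ J₂ c = y.actInf₁ J₁ J₂ a + y.actInf₁ J₁ J₂ b :=
  LinearMap.ext fun η => Subtype.ext <| by
    change y.ρ c η = y.ρ a η + y.ρ b η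
    rw [h, map_add, LinearMap.add_apply]

theorem actInf₂_add (a b c : J₂) (h : (c : A) = a + b) :
    x.actInf₂ J₁ J₂ c = x.actInf₂ J₁ J₂ a + x.actInf₂ J₁ J₂ b :=
  LinearMap.ext fun η => Subtype.ext <| by
    change x.ρ c η = x.ρ a η + x.ρ b η
    rw [h, map_add, LinearMap.add_apply]

theorem pairing_add (ξ : x.sub J₁) (η : y.sub J₂) (a₁ b₁ c₁ : J₁) (a₂ b₂ c₂ : J₂)
    (h₁ : (c₁ : A) = a₁ + b₁) (h₂ : (c₂ : A) = a₂ + b₂) :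
    T.pairing ξ η c₁ c₂ = T.pairing ξ η a₁ a₂ + T.pairing ξ η b₁ b₂ := by
  rw [pairing, actInf₁_add a₁ b₁ c₁ h₁, actInf₂_add a₂ b₂ c₂ h₂, LinearMap.add_apply,
    LinearMap.add_apply, map_add, map_add, Submodule.coe_add, Submodule.coe_add,
    CStarModule.inner_add_left, CStarModule.inner_add_right, pairing, pairing]
  abel

theorem inner_act_left (hx : ∀ a : A, IsAdjointPair B (x.ρ a) (x.ρ (star a)))
    (a : A) (φ : J₁) (ξ : x.sub J₁) (η : y.sub J₂) :
    ⟪x.ρ a (ξ : x.H), (T.T.symm (y.actInf₁ J₁ J₂ φ η) : x.H)⟫_B =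
      ⟪(ξ : x.H), (T.T.symm (y.actInf₁ J₁ J₂ ⟨star a * φ, J₁.mul_mem_left _ _ φ.2⟩ η) : x.H)⟫_B := by
  rw [hx]
  congr 1
  have h := T.symm_map_act (star a) (y.actInf₁ J₁ J₂ φ η)
  refine (congrArg Subtype.val h).symm.trans ?_
  congr 2
  exact Subtype.ext (y.ρ_mul_apply _ _ _).symm

theorem inner_act_right (hy : ∀ a : A, IsAdjointPair B (y.ρ a) (y.ρ (star a)))
    (a : A) (φ : J₂) (ξ : x.sub J₁) (η : y.sub J₂) :
    ⟪(T.T (x.actInf₂ J₁ J₂ φ ξ) : y.H), y.ρ a (η : y.H)⟫_B =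
      ⟪(T.T (x.actInf₂ J₁ J₂ ⟨star a * φ, J₂.mul_mem_left _ _ φ.2⟩ ξ) : y.H), (η : y.H)⟫_B := by
  rw [← (hy a).symm]
  congr 1
  have h := T.map_act (star a) (x.actInf₂ J₁ J₂ φ ξ)
  refine (congrArg Subtype.val h).symm.trans ?_
  congr 2
  exact Subtype.ext (x.ρ_mul_apply _ _ _).symm

theorem pairing_act_left (hx : ∀ a : A, IsAdjointPair B (x.ρ a) (x.ρ (star a)))
    (a : A) (ξ : x.sub J₁) (η : y.sub J₂) (φ₁ : J₁) (φ₂ : J₂) :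
    T.pairing (x.act J₁ a ξ) η φ₁ φ₂ =
      T.pairing ξ η ⟨star a * φ₁, J₁.mul_mem_left _ _ φ₁.2⟩ ⟨φ₂ * a, J₂.mul_mem_right _ _ φ₂.2⟩ := by
  refine congrArg₂ (· + ·) (T.inner_act_left hx a φ₁ ξ η) ?_
  congr 3
  exact Subtype.ext (x.ρ_mul_apply _ _ _).symm

theorem pairing_act_right (hy : ∀ a : A, IsAdjointPair B (y.ρ a) (y.ρ (star a)))
    (a : A) (ξ : x.sub J₁) (η : y.sub J₂) (φ₁ : J₁) (φ₂ : J₂) :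
    T.pairing ξ (y.act J₂ a η) φ₁ φ₂ =
      T.pairing ξ η ⟨φ₁ * a, J₁.mul_mem_right _ _ φ₁.2⟩ ⟨star a * φ₂, J₂.mul_mem_left _ _ φ₂.2⟩ := by
  refine congrArg₂ (· + ·) ?_ (T.inner_act_right hy a φ₂ ξ η)
  congr 3
  exact Subtype.ext (y.ρ_mul_apply _ _ _).symm

/-- The pairing only depends on `φ₁ + φ₂*`. -/
theorem pairing_congr (hx : ∀ a : A, IsAdjointPair B (x.ρ a) (x.ρ (star a)))
    (hy : ∀ a : A, IsAdjointPair B (y.ρ a) (y.ρ (star a)))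
    (h₁ : J₁.IsClosedStar) (h₂ : J₂.IsClosedStar) (ξ : x.sub J₁) (η : y.sub J₂) {a₁ b₁ : J₁}
    {a₂ b₂ : J₂} (h : (a₁ : A) + star (a₂ : A) = b₁ + star (b₂ : A)) :
    T.pairing ξ η a₁ a₂ = T.pairing ξ η b₁ b₂ := by
  have e : (a₁ : A) - b₁ = star ((b₂ : A) - a₂) := by
    rw [star_sub, sub_eq_sub_iff_add_eq_add, h, add_comm]
  have hj₂ : (b₂ : A) - a₂ ∈ J₂ := J₂.sub_mem b₂.2 a₂.2
  have hk₁ : star ((b₂ : A) - a₂) ∈ J₁ := e ▸ J₁.sub_mem a₁.2 b₁.2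
  -- The discrepancy between the two choices lies in both ideals, so it may be moved through $T$
  -- from one summand of the pairing to the other.
  have hj : (b₂ : A) - a₂ ∈ J₁ ⊓ J₂ := by
    refine (TwoSidedIdeal.mem_inf A).mpr ⟨?_, hj₂⟩
    have := h₁.star_mem _ hk₁
    rwa [star_star] at this
  have hT : ⟪(T.T (x.actInf₂ J₁ J₂ ⟨_, hj₂⟩ ξ) : y.H), (η : y.H)⟫_B =
      ⟪(ξ : x.H), (T.T.symm (y.actInf₁ J₁ J₂ ⟨_, hk₁⟩ η) : x.H)⟫_B :=
    T.isAdjointPair_transfer (h₁.inf h₂) hx hy ⟨_, hj⟩ ξ η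
  rw [pairing, pairing, actInf₁_add b₁ ⟨_, hk₁⟩ a₁ (by simp [← e]),
    actInf₂_add a₂ ⟨_, hj₂⟩ b₂ (by simp), LinearMap.add_apply,
    LinearMap.add_apply, map_add, map_add, Submodule.coe_add, Submodule.coe_add,
    CStarModule.inner_add_left, CStarModule.inner_add_right, hT]
  abel

end Agreement

/-! ### Identities for the partition -/

namespace SquarePartition

variable [PartialOrder A] [StarOrderedRing A] {J₁ J₂ : TwoSidedIdeal A} (ψ : SquarePartition J₁ J₂)

theorem star_ψ₁ : star (ψ.ψ₁ : A) = ψ.ψ₁ := (IsSelfAdjoint.of_nonneg ψ.nonneg₁).star_eq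

theorem star_ψ₂ : star (ψ.ψ₂ : A) = ψ.ψ₂ := (IsSelfAdjoint.of_nonneg ψ.nonneg₂).star_eq

theorem mul_self_add_mul_self : (ψ.ψ₁ : A) * ψ.ψ₁ + (ψ.ψ₂ : A) * ψ.ψ₂ = 1 := by
  rw [← pow_two, ← pow_two, ψ.sq_add_sq]

theorem star_sq₁ : star (ψ.sq₁ : A) = ψ.sq₁ :=
  (star_pow _ _).trans (by rw [star_ψ₁]; rfl)

theorem star_sq₂ : star (ψ.sq₂ : A) = ψ.sq₂ :=
  (star_pow _ _).trans (by rw [star_ψ₂]; rfl)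

theorem star_cross : star (ψ.cross : A) = ψ.cross :=
  (star_mul _ _).trans (by rw [star_ψ₁, star_ψ₂, ← ψ.commute]; rfl)

theorem sq₁_add_sq₂ : (ψ.sq₁ : A) + ψ.sq₂ = 1 := ψ.sq_add_sq

theorem cross_mem_right : (ψ.cross : A) ∈ J₂ := J₂.mul_mem_left _ _ ψ.ψ₂.2

theorem cross_mul_cross : (ψ.cross : A) * ψ.cross = ψ.sq₁ * ψ.sq₂ :=
  (Commute.mul_pow (show Commute (ψ.ψ₁ : A) ψ.ψ₂ from ψ.commute) 2 ▸
    (pow_two ((ψ.ψ₁ : A) * ψ.ψ₂)).symm :)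

theorem sq₂_mul_sq₁ : (ψ.sq₂ : A) * ψ.sq₁ = ψ.sq₁ * ψ.sq₂ :=
  (((show Commute (ψ.ψ₁ : A) ψ.ψ₂ from ψ.commute).pow_pow 2 2).eq).symm

/-- One of the two copies of the cross term completes $\psi_1^4$ to $\psi_1^2$; the other does the
same for $\psi_2$. This accounts for the coefficient 2 in the inner product. -/
theorem sq₁_mul_sq₁_add : (ψ.sq₁ : A) * ψ.sq₁ + ψ.cross * ψ.cross = ψ.sq₁ := by
  rw [cross_mul_cross, ← mul_add, sq₁_add_sq₂, mul_one]

theorem sq₂_mul_sq₂_add : (ψ.sq₂ : A) * ψ.sq₂ + ψ.cross * ψ.cross = ψ.sq₂ := by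
  rw [cross_mul_cross, ← sq₂_mul_sq₁, ← mul_add, add_comm (ψ.sq₂ : A), sq₁_add_sq₂, mul_one]

end SquarePartition

namespace KTriple

theorem inner_partition {x : KTriple.{u, v, w} A B}
    (hx : ∀ a : A, IsAdjointPair B (x.ρ a) (x.ρ (star a)))
    [PartialOrder A] [StarOrderedRing A] {J₁ J₂ : TwoSidedIdeal A} (ψ : SquarePartition J₁ J₂)
    (ξ η : x.H) :
    ⟪x.ρ ψ.sq₁ ξ, x.ρ ψ.sq₁ η⟫_B + ⟪x.ρ ψ.sq₂ ξ, x.ρ ψ.sq₂ η⟫_B +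
      2 • ⟪x.ρ ψ.cross ξ, x.ρ ψ.cross η⟫_B = ⟪ξ, η⟫_B := by
  rw [hx, hx, hx, ψ.star_sq₁, ψ.star_sq₂, ψ.star_cross, ← ρ_mul_apply, ← ρ_mul_apply,
    ← ρ_mul_apply, two_nsmul, ← CStarModule.inner_add_right, ← CStarModule.inner_add_right,
    ← CStarModule.inner_add_right, ← LinearMap.add_apply, ← LinearMap.add_apply,
    ← LinearMap.add_apply, ← map_add, ← map_add, ← map_add, add_add_add_comm,
    ψ.sq₁_mul_sq₁_add, ψ.sq₂_mul_sq₂_add, ψ.sq₁_add_sq₂, map_one, Module.End.one_apply]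

end KTriple

/-! ### The glued inner product and the glued module -/

namespace Agreement

variable {J₁ J₂ : TwoSidedIdeal A} {x : KTriple.{u, v, w} A B} {y : KTriple.{u, v, w'} A B}
  (T : Agreement (J₁ ⊓ J₂) x y) [PartialOrder A] [StarOrderedRing A] (ψ : SquarePartition J₁ J₂)

theorem gluedInner_ι₁ (hx : ∀ a : A, IsAdjointPair B (x.ρ a) (x.ρ (star a))) (ξ η : x.sub J₁) :
    T.gluedInner ψ (T.ι₁ ξ) (T.ι₁ η) = ⟪ξ, η⟫_B := by
  rw [gluedInner, toLeft_ι₁, toLeft_ι₁, toLeft_ι₁, toLeft_ι₁, toRight_ι₁, toRight_ι₁]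
  have h : ⟪incl₂ J₁ J₂ y (T.T (x.actInf₂ J₁ J₂ ψ.sq₂ ξ)),
      incl₂ J₁ J₂ y (T.T (x.actInf₂ J₁ J₂ ψ.sq₂ η))⟫_B = ⟪x.ρ ψ.sq₂ (ξ : x.H), x.ρ ψ.sq₂ η⟫_B :=
    T.inner_map _ _
  rw [h]
  exact x.inner_partition hx ψ ξ η

theorem gluedInner_ι₂ (hy : ∀ a : A, IsAdjointPair B (y.ρ a) (y.ρ (star a))) (ξ η : y.sub J₂) :
    T.gluedInner ψ (T.ι₂ ξ) (T.ι₂ η) = ⟪ξ, η⟫_B := by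
  rw [gluedInner, toLeft_ι₂, toLeft_ι₂, toLeft_ι₂, toLeft_ι₂, toRight_ι₂, toRight_ι₂]
  have h : ∀ φ : J₁, ⟪incl₁ J₁ J₂ x (T.T.symm (y.actInf₁ J₁ J₂ φ ξ)),
      incl₁ J₁ J₂ x (T.T.symm (y.actInf₁ J₁ J₂ φ η))⟫_B = ⟪y.ρ φ (ξ : y.H), y.ρ φ η⟫_B :=
    fun φ => T.inner_symm_map _ _
  rw [h, h]
  exact y.inner_partition hy ψ ξ η

/-- One copy of the cross term stays in $H$ and joins the $\psi_1^4$ term; the other is carried by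
$T$ to $\widetilde H$ and joins the $\psi_2^4$ term. -/
theorem gluedInner_ι₁_ι₂ (hx : ∀ a : A, IsAdjointPair B (x.ρ a) (x.ρ (star a)))
    (hy : ∀ a : A, IsAdjointPair B (y.ρ a) (y.ρ (star a))) (ξ : x.sub J₁) (η : y.sub J₂) :
    T.gluedInner ψ (T.ι₁ ξ) (T.ι₂ η) = T.pairing ξ η ψ.sq₁ ψ.sq₂ := by
  rw [gluedInner, toLeft_ι₁, toLeft_ι₂, toLeft_ι₁, toLeft_ι₂, toRight_ι₁, toRight_ι₂]
  have h₁ : ∀ φ : J₁, ⟪x.act J₁ φ ξ, incl₁ J₁ J₂ x (T.T.symm (y.actInf₁ J₁ J₂ φ η))⟫_B =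
      ⟪(ξ : x.H), (T.T.symm (y.actInf₁ J₁ J₂
        ⟨star (φ : A) * φ, J₁.mul_mem_left _ _ φ.2⟩ η) : x.H)⟫_B :=
    fun φ => T.inner_act_left hx φ φ ξ η
  have h₂ : ∀ φ : J₂, ⟪incl₂ J₁ J₂ y (T.T (x.actInf₂ J₁ J₂ φ ξ)), y.act J₂ φ η⟫_B =
      ⟪(T.T (x.actInf₂ J₁ J₂ ⟨star (φ : A) * φ, J₂.mul_mem_left _ _ φ.2⟩ ξ) : y.H), (η : y.H)⟫_B :=
    fun φ => T.inner_act_right hy φ φ ξ η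
  have h₃ : ⟪x.act J₁ ψ.cross ξ, incl₁ J₁ J₂ x (T.T.symm (y.actInf₁ J₁ J₂ ψ.cross η))⟫_B =
      ⟪incl₂ J₁ J₂ y (T.T (x.actInf₂ J₁ J₂ ⟨ψ.cross, ψ.cross_mem_right⟩ ξ)),
        y.act J₂ ψ.cross η⟫_B :=
    (T.isAdjointPair (x.actInf₂ J₁ J₂ ⟨ψ.cross, ψ.cross_mem_right⟩ ξ)
      (y.actInf₁ J₁ J₂ ψ.cross η)).symm
  rw [T.pairing_add ξ η ⟨star (ψ.sq₁ : A) * ψ.sq₁, J₁.mul_mem_left _ _ ψ.sq₁.2⟩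
    ⟨star (ψ.cross : A) * ψ.cross, J₁.mul_mem_left _ _ ψ.cross.2⟩ ψ.sq₁
    ⟨star (ψ.sq₂ : A) * ψ.sq₂, J₂.mul_mem_left _ _ ψ.sq₂.2⟩
    ⟨star (ψ.cross : A) * ψ.cross, J₂.mul_mem_left _ _ ψ.cross_mem_right⟩ ψ.sq₂
    (by rw [ψ.star_sq₁, ψ.star_cross, ψ.sq₁_mul_sq₁_add])
    (by rw [ψ.star_sq₂, ψ.star_cross, ψ.sq₂_mul_sq₂_add]), two_nsmul]
  exact congrArg₂ (· + ·) (congrArg₂ (· + ·) (h₁ ψ.sq₁) (h₂ ψ.sq₂))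
    (congrArg₂ (· + ·) (h₁ ψ.cross) (h₃.trans (h₂ ⟨ψ.cross, ψ.cross_mem_right⟩)))

theorem star_gluedInner (ξ η : T.GluedSpace) :
    star (T.gluedInner ψ ξ η) = T.gluedInner ψ η ξ := by
  simp only [gluedInner, star_add, star_nsmul, CStarModule.star_inner]

theorem gluedInner_add_add (a b c d : T.GluedSpace) :
    T.gluedInner ψ (a + b) (c + d) = T.gluedInner ψ a c + T.gluedInner ψ a d +
      (star (T.gluedInner ψ c b) + T.gluedInner ψ b d) := by
  rw [star_gluedInner]
  simp only [gluedInner, map_add, CStarModule.inner_add_left, CStarModule.inner_add_right, smul_add]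
  abel

/-- Only the mixed products need an argument. Both sides are pairings with
$\varphi_1+\varphi_2^*=a^*$: one as $a^*(\psi_1^2+\psi_2^2)$, the other as $(\psi_1^2+\psi_2^2)a^*$.
-/
theorem gluedInner_gluedAct (h₁ : J₁.IsClosedStar) (h₂ : J₂.IsClosedStar)
    (hx : ∀ a : A, IsAdjointPair B (x.ρ a) (x.ρ (star a)))
    (hy : ∀ a : A, IsAdjointPair B (y.ρ a) (y.ρ (star a))) (a : A) (ζ ζ' : T.GluedSpace) :
    T.gluedInner ψ (T.gluedAct a ζ) ζ' = T.gluedInner ψ ζ (T.gluedAct (star a) ζ') := by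
  have key : ∀ (a : A) (ξ : x.sub J₁) (η : y.sub J₂), T.gluedInner ψ (T.ι₁ (x.act J₁ a ξ)) (T.ι₂ η) =
      T.gluedInner ψ (T.ι₁ ξ) (T.ι₂ (y.act J₂ (star a) η)) := by
    intro a ξ η
    rw [T.gluedInner_ι₁_ι₂ ψ hx hy, T.gluedInner_ι₁_ι₂ ψ hx hy, T.pairing_act_left hx,
      T.pairing_act_right hy]
    refine T.pairing_congr hx hy h₁ h₂ ξ η ?_
    simp only [star_mul, star_star]
    rw [ψ.star_sq₂, ← mul_add, ← add_mul, ψ.sq₁_add_sq₂, one_mul, mul_one]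
  obtain ⟨⟨ξ, η⟩, rfl⟩ := T.cls_surjective ζ
  obtain ⟨⟨ξ', η'⟩, rfl⟩ := T.cls_surjective ζ'
  rw [gluedAct_cls, gluedAct_cls, cls_eq, cls_eq, cls_eq, cls_eq, gluedInner_add_add,
    gluedInner_add_add, T.gluedInner_ι₁ ψ hx, T.gluedInner_ι₁ ψ hx, T.gluedInner_ι₂ ψ hy,
    T.gluedInner_ι₂ ψ hy, key a, key (star a), star_star]
  exact congrArg₂ (· + ·) (congrArg (· + _) (hx a ξ ξ')) (congrArg (_ + ·) (hy a η η'))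

theorem gluedInner_eq (h₁ : J₁.IsClosedStar) (h₂ : J₂.IsClosedStar)
    (hx : ∀ a : A, IsAdjointPair B (x.ρ a) (x.ρ (star a)))
    (hy : ∀ a : A, IsAdjointPair B (y.ρ a) (y.ρ (star a))) (ψ' : SquarePartition J₁ J₂)
    (ζ ζ' : T.GluedSpace) : T.gluedInner ψ ζ ζ' = T.gluedInner ψ' ζ ζ' := by
  have key : ∀ (ξ : x.sub J₁) (η : y.sub J₂), T.gluedInner ψ (T.ι₁ ξ) (T.ι₂ η) =
      T.gluedInner ψ' (T.ι₁ ξ) (T.ι₂ η) := by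
    intro ξ η
    rw [T.gluedInner_ι₁_ι₂ ψ hx hy, T.gluedInner_ι₁_ι₂ ψ' hx hy]
    refine T.pairing_congr hx hy h₁ h₂ ξ η ?_
    rw [ψ.star_sq₂, ψ'.star_sq₂, ψ.sq₁_add_sq₂, ψ'.sq₁_add_sq₂]
  obtain ⟨⟨ξ, η⟩, rfl⟩ := T.cls_surjective ζ
  obtain ⟨⟨ξ', η'⟩, rfl⟩ := T.cls_surjective ζ'
  rw [cls_eq, cls_eq, gluedInner_add_add, gluedInner_add_add, T.gluedInner_ι₁ ψ hx,
    T.gluedInner_ι₁ ψ' hx, T.gluedInner_ι₂ ψ hy, T.gluedInner_ι₂ ψ' hy, key, key]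

/-- The natural map of `H₁` as a chart of the glued triple. -/
def chart₁ (hx : ∀ a : A, IsAdjointPair B (x.ρ a) (x.ρ (star a))) : Chart J₁ x (T.glue ψ) where
  ι := (T.toGlue ψ).toLinearMap ∘ₗ T.ι₁
  π c := T.toLeft c ∘ₗ (T.toGlue ψ).symm.toLinearMap
  inner_map := T.gluedInner_ι₁ ψ hx
  map_act a ξ := (T.gluedAct_ι₁ a ξ).symm
  map_smul := T.smul_ι₁
  ι_π := T.ι₁_toLeft

/-- The natural map of `H'₂` as a chart of the glued triple. -/
def chart₂ (hy : ∀ a : A, IsAdjointPair B (y.ρ a) (y.ρ (star a))) : Chart J₂ y (T.glue ψ) where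
  ι := (T.toGlue ψ).toLinearMap ∘ₗ T.ι₂
  π c := T.toRight c ∘ₗ (T.toGlue ψ).symm.toLinearMap
  inner_map := T.gluedInner_ι₂ ψ hy
  map_act a ξ := (T.gluedAct_ι₂ a ξ).symm
  map_smul := T.smul_ι₂
  ι_π := T.ι₂_toRight

/-- A change of chart is a transfer along an element of $J_1\cap J_2$; this is how the given
agreement enters the gluing. -/
theorem pull_chart₂_comp_push_chart₁ (hx : ∀ a : A, IsAdjointPair B (x.ρ a) (x.ρ (star a)))
    (hy : ∀ a : A, IsAdjointPair B (y.ρ a) (y.ρ (star a))) (c : J₁) (d : J₂) :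
    (T.chart₂ ψ hy).pull d ∘ₗ (T.chart₁ ψ hx).push c = T.transfer ⟨d * c,
      (TwoSidedIdeal.mem_inf A).mpr ⟨J₁.mul_mem_left _ _ c.2, J₂.mul_mem_right _ _ d.2⟩⟩ := by
  refine LinearMap.ext fun ξ => ?_
  refine (congrArg Subtype.val (T.toRight_ι₁ d (x.actInto J₁ c ξ))).trans ?_
  exact congrArg (fun t => (T.T t : y.H)) (Subtype.ext (x.ρ_mul_apply d c ξ).symm)

theorem pull_chart₁_comp_push_chart₂ (hx : ∀ a : A, IsAdjointPair B (x.ρ a) (x.ρ (star a)))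
    (hy : ∀ a : A, IsAdjointPair B (y.ρ a) (y.ρ (star a))) (c : J₁) (d : J₂) :
    (T.chart₁ ψ hx).pull c ∘ₗ (T.chart₂ ψ hy).push d = T.symm.transfer ⟨c * d,
      (TwoSidedIdeal.mem_inf A).mpr ⟨J₁.mul_mem_right _ _ c.2, J₂.mul_mem_left _ _ d.2⟩⟩ := by
  refine LinearMap.ext fun η => ?_
  refine (congrArg Subtype.val (T.toLeft_ι₂ c (y.actInto J₂ d η))).trans ?_
  exact congrArg (fun t => (T.T.symm t : x.H)) (Subtype.ext (y.ρ_mul_apply c d η).symm)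

/-- The glued triple with its two charts. -/
def gluing (h₁ : J₁.IsClosedStar) (h₂ : J₂.IsClosedStar) (hx : x.IsUnitalKasparov)
    (hy : y.IsUnitalKasparov) : Gluing J₁ J₂ x y (T.glue ψ) where
  chart₁ := T.chart₁ ψ hx.ρ_star
  chart₂ := T.chart₂ ψ hy.ρ_star
  isClosedStar₁ := h₁
  isClosedStar₂ := h₂
  kasparov₁ := hx
  kasparov₂ := hy
  ρ_star a := T.gluedInner_gluedAct ψ h₁ h₂ hx.ρ_star hy.ρ_star a
  transition₁ c d := by
    rw [pull_chart₂_comp_push_chart₁]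
    exact T.transfer_compactEq (h₁.inf h₂) hx hy _
  transition₂ c d := by
    rw [pull_chart₁_comp_push_chart₂]
    exact T.symm.transfer_compactEq (h₁.inf h₂) hy hx _

theorem glue_F (h₁ : J₁.IsClosedStar) (h₂ : J₂.IsClosedStar) (hx : x.IsUnitalKasparov)
    (hy : y.IsUnitalKasparov) :
    (T.glue ψ).F = (T.gluing ψ h₁ h₂ hx hy).op ψ.ψ₁ ψ.ψ₂ x.F y.F := rfl

theorem glue_isUnitalKasparov (h₁ : J₁.IsClosedStar) (h₂ : J₂.IsClosedStar)
    (hx : x.IsUnitalKasparov) (hy : y.IsUnitalKasparov) : (T.glue ψ).IsUnitalKasparov :=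
  (T.gluing ψ h₁ h₂ hx hy).isUnitalKasparov ψ.mul_self_add_mul_self ψ.star_ψ₁ ψ.star_ψ₂
    (T.glue_F ψ h₁ h₂ hx hy)

theorem glue_isCompactPerturbation (h₁ : J₁.IsClosedStar) (h₂ : J₂.IsClosedStar)
    (hx : x.IsUnitalKasparov) (hy : y.IsUnitalKasparov) (ψ' : SquarePartition J₁ J₂) :
    IsCompactPerturbation (T.glue ψ) (T.glue ψ') ((T.toGlue ψ).symm.trans (T.toGlue ψ')) := by
  have hU : ∀ ξ η : (T.glue ψ).H, ⟪(T.toGlue ψ).symm.trans (T.toGlue ψ') ξ,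
      (T.toGlue ψ).symm.trans (T.toGlue ψ') η⟫_B = ⟪ξ, η⟫_B := fun ξ η =>
    T.gluedInner_eq ψ' h₁ h₂ hx.ρ_star hy.ρ_star ψ ξ η
  have hsmul : ∀ (b : B) (ξ : (T.glue ψ).H), (T.toGlue ψ).symm.trans (T.toGlue ψ') (b • ξ) =
      b • (T.toGlue ψ).symm.trans (T.toGlue ψ') ξ := fun _ _ => rfl
  refine ⟨hU, fun _ _ => rfl, hsmul, ?_⟩
  -- Both operators are compared inside the module of `ψ`. The underlying chart maps do not involve
  -- the partition, so the operator built there from `ψ'` corresponds to the one of `T.glue ψ'` by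
  -- definition.
  have hc : CompactEq B (T.glue ψ).F
      ((T.gluing ψ h₁ h₂ hx hy).op ψ'.ψ₁ ψ'.ψ₂ x.F y.F) := by
    rw [T.glue_F ψ h₁ h₂ hx hy]
    exact (T.gluing ψ h₁ h₂ hx hy).op_compactEq_op ψ.mul_self_add_mul_self ψ'.mul_self_add_mul_self
  have h := hc.comp_left (isBoundedModuleMap_of_inner_map
    (S := ((T.toGlue ψ).symm.trans (T.toGlue ψ')).toLinearMap) hU hsmul)
  have e : ((T.toGlue ψ).symm.trans (T.toGlue ψ')).toLinearMap ∘ₗ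
      (T.gluing ψ h₁ h₂ hx hy).op ψ'.ψ₁ ψ'.ψ₂ x.F y.F =
      (T.glue ψ').F ∘ₗ ((T.toGlue ψ).symm.trans (T.toGlue ψ')).toLinearMap :=
    LinearMap.ext fun _ => rfl
  rw [e] at h
  exact h

end Agreement

end

theorem theorem1 {A : Type u} {B : Type v} [CStarAlgebra A] [PartialOrder A] [StarOrderedRing A]
    [NonUnitalCStarAlgebra B] [PartialOrder B] [StarOrderedRing B]
    (J₁ J₂ : TwoSidedIdeal A)
    (hclosed₁ : IsClosed (J₁ : Set A)) (hclosed₂ : IsClosed (J₂ : Set A))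
    (hstar₁ : ∀ a ∈ J₁, star a ∈ J₁) (hstar₂ : ∀ a ∈ J₂, star a ∈ J₂)
    (hsum : ∀ a : A, ∃ a₁ ∈ J₁, ∃ a₂ ∈ J₂, a₁ + a₂ = a)
    (x : KTriple.{u, v, w} A B) (y : KTriple.{u, v, w'} A B)
    (hx : x.IsUnitalKasparov) (hy : y.IsUnitalKasparov)
    (T : Agreement (J₁ ⊓ J₂) x y) :
    (∀ ψ : SquarePartition J₁ J₂,
      (T.glue ψ).IsUnitalKasparov ∧
      (∃ S : Agreement J₁ x (T.glue ψ),
        ∀ ξ : x.sub J₁, (S.T ξ : (T.glue ψ).H) = T.toGlue ψ (T.ι₁ ξ)) ∧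
      (∃ S : Agreement J₂ y (T.glue ψ),
        ∀ η : y.sub J₂, (S.T η : (T.glue ψ).H) = T.toGlue ψ (T.ι₂ η))) ∧
    (∀ ψ ψ' : SquarePartition J₁ J₂,
      IsCompactPerturbation (T.glue ψ) (T.glue ψ')
        ((T.toGlue ψ).symm.trans (T.toGlue ψ'))) := by
  have h₁ : J₁.IsClosedStar := ⟨hclosed₁, hstar₁⟩
  have h₂ : J₂.IsClosedStar := ⟨hclosed₂, hstar₂⟩
  refine ⟨fun ψ => ?_, fun ψ ψ' => T.glue_isCompactPerturbation ψ h₁ h₂ hx hy ψ'⟩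
  have hz := T.glue_isUnitalKasparov ψ h₁ h₂ hx hy
  refine ⟨hz, ⟨(T.chart₁ ψ hx.ρ_star).agreement h₁ hx hz fun c => ?_, fun _ => rfl⟩,
    ⟨(T.chart₂ ψ hy.ρ_star).agreement h₂ hy hz fun c => ?_, fun _ => rfl⟩⟩
  · rw [T.glue_F ψ h₁ h₂ hx hy]
    exact (T.gluing ψ h₁ h₂ hx hy).op_comp_push₁ ψ.mul_self_add_mul_self c
  · rw [T.glue_F ψ h₁ h₂ hx hy]
    exact (T.gluing ψ h₁ h₂ hx hy).op_comp_push₂ ψ.mul_self_add_mul_self c
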